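/- Let $n\ge 1$ and let $a,b,c\in C^\infty(\mathbb R^n)$ satisfy, for all $x\in\mathbb R^n$, $$a_0(1+|x|)^{-\alpha}\le a(x)\le a_1(1+|x|)^{-\alpha},\quad b_0(1+|x|)^{\beta}\le b(x)\le b_1(1+|x|)^{\beta},\quad c_0(1+|x|)^{-\gamma}\le c(x)\le c_1(1+|x|)^{-\gamma},$$ with positive constants $a_i,b_i,c_i$ and real exponents $\alpha,\beta,\gamma$ such that $\beta+\gamma<2$. Call $q\in C^1([0,\infty))$ admissible if $$0<q'(|x|)\le\sqrt{c(x)/b(x)}\quad\text{for all }x\in\mathbb R^n.$$ (i) There exist an admissible $q$ and a constant $q_0>0$ such that $$q(|x|)\ge q_0|x|^{1-(\beta+\gamma)/2}\quad\text{for all }x\in\mathbb R^n.\tag{$*$}$$ (ii) Let $q$ be admissible and $q_0>0$ such that $(*)$ holds, and let $R\ge 0$. Let $h\in C((0,\infty),L^2(\mathbb R^n))$ with $h(x,t)=0$ whenever $q(|x|)>t+q(R)$, let $(u_0,u_1)\in H^1(\mathbb R^n)\times L^2(\mathbb R^n)$ with $u_0(x)=u_1(x)=0$ for $|x|>R$,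 and let $u\in C((0,\infty),H^1(\mathbb R^n))\cap C^1((0,\infty),L^2(\mathbb R^n))$ be a real-valued solution, in the sense of distributions on $\mathbb R^n\times(0,\infty)$, of $$c(x)u_{tt}-\operatorname{div}(b(x)\nabla u)+a(x)u_t=h,$$ with data $(u,u_t)|_{t=0}=(u_0,u_1)$, attained as limits in $H^1\times L^2$ as $t\to0^+$. Then, for every $t>0$, $$u(x,t)=0\quad\text{for almost every }x\text{ with }|x|>\left(\frac{t+q(R)}{q_0}\right)^{2/(2-\beta-\gamma)}.$$ -/

import Mathlib

open MeasureTheory Set Filter Topology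
open scoped ContDiff Gradient

noncomputable section

namespace DampedWave

/-- Euclidean space `ℝⁿ`. -/
abbrev E (n : ℕ) : Type := EuclideanSpace ℝ (Fin n)

/-- Real-valued `L²(ℝⁿ)`. -/
abbrev L2 (n : ℕ) : Type := Lp ℝ 2 (volume : Measure (E n))

/-- `L²(ℝⁿ; ℝⁿ)`, the space of square integrable vector fields. -/
abbrev L2Vec (n : ℕ) : Type := Lp (E n) 2 (volume : Measure (E n))

/-- `g` is the weak gradient of `f`: `∫ f ∇φ dx = - ∫ φ g dx` for all `φ ∈ C_c^∞(ℝⁿ)`. -/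
def IsWeakGradient {n : ℕ} (f : L2 n) (g : L2Vec n) : Prop :=
  ∀ φ : E n → ℝ, ContDiff ℝ ∞ φ → HasCompactSupport φ →
    ∫ x, f x • ∇ φ x = - ∫ x, φ x • g x

/-- The Sobolev space `H¹(ℝⁿ)`: the pairs `(f, ∇f)` with `f ∈ L²` and weak gradient `∇f ∈ L²`.
The weak gradient is unique, so such a pair is the same as a function of `H¹`.  The metric is the
one of the `ℓ²`-product `L² × L²`, that is, of the norm `(‖f‖² + ‖∇f‖²)^(1/2)`. -/
def H1 (n : ℕ) : Type :=
  {p : WithLp 2 (L2 n × L2Vec n) // IsWeakGradient p.fst p.snd}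

instance (n : ℕ) : MetricSpace (H1 n) :=
  inferInstanceAs (MetricSpace {p : WithLp 2 (L2 n × L2Vec n) // IsWeakGradient p.fst p.snd})

/-- The underlying `L²` function of an element of `H¹`. -/
def H1.fn {n : ℕ} (f : H1 n) : L2 n := f.val.fst

/-- The weak gradient of an element of `H¹`. -/
def H1.grad {n : ℕ} (f : H1 n) : L2Vec n := f.val.snd

/-- `k₀ (1 + |x|)^e ≤ f(x) ≤ k₁ (1 + |x|)^e` for all `x ∈ ℝⁿ`. -/
def PowerBounds {n : ℕ} (f : E n → ℝ) (k₀ k₁ e : ℝ) : Prop :=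
  ∀ x : E n, k₀ * (1 + ‖x‖) ^ e ≤ f x ∧ f x ≤ k₁ * (1 + ‖x‖) ^ e

/-- `q ∈ C¹([0,∞))` and `0 < q'(|x|) ≤ √(c(x) / b(x))` for all `x ∈ ℝⁿ` (with the one-sided
derivative at `0`). -/
def IsAdmissible {n : ℕ} (b c : E n → ℝ) (q : ℝ → ℝ) : Prop :=
  ContDiffOn ℝ 1 q (Ici 0) ∧
    ∀ x : E n, 0 < derivWithin q (Ici 0) ‖x‖ ∧
      derivWithin q (Ici 0) ‖x‖ ≤ Real.sqrt (c x / b x)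

/-- The equation `c u_tt - div (b ∇u) + a u_t = h` on `ℝⁿ × (0,∞)` in the sense of distributions,
where `v` stands for `u_t`: it is tested with all `φ ∈ C_c^∞((0,∞) × ℝⁿ)`. -/
def WeakEquation {n : ℕ} (a b c : E n → ℝ) (h : ℝ → L2 n) (u : ℝ → H1 n) (v : ℝ → L2 n) : Prop :=
  ∀ φ : ℝ × E n → ℝ, ContDiff ℝ ∞ φ → HasCompactSupport φ → tsupport φ ⊆ {p | 0 < p.1} →
    ∫ t in Ioi (0 : ℝ), ∫ x : E n,
        (-(c x * v t x * deriv (fun s => φ (s, x)) t)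
          + b x * inner ℝ ((u t).grad x) (∇ (fun y => φ (t, y)) x)
          + a x * v t x * φ (t, x))
      = ∫ t in Ioi (0 : ℝ), ∫ x : E n, h t x * φ (t, x)

/-- `u ∈ C((0,∞), H¹) ∩ C¹((0,∞), L²)` is a (weak) solution of `c u_tt - div (b ∇u) + a u_t = h`
with data `(u, u_t)|_{t=0} = (u₀, u₁)`; the data are attained in `H¹ × L²` as `t → 0+`. -/
def IsSolution {n : ℕ} (a b c : E n → ℝ) (h : ℝ → L2 n) (u₀ : H1 n) (u₁ : L2 n)
    (u : ℝ → H1 n) : Prop :=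
  ∃ v : ℝ → L2 n,
    ContinuousOn u (Ioi 0) ∧ ContinuousOn v (Ioi 0) ∧
    (∀ t : ℝ, 0 < t → HasDerivAt (fun s => (u s).fn) (v t) t) ∧
    Tendsto u (𝓝[>] 0) (𝓝 u₀) ∧ Tendsto v (𝓝[>] 0) (𝓝 u₁) ∧
    WeakEquation a b c h u v

end DampedWave

end

/-! Part (ii) is a weighted energy estimate. Let `d = q(|x|) - q(R)`. If `p` is a function with
`|∇p| ≤ √(c/b)`, the energy of `(u_t, ∇u)` with weight `w = max(p - t, 0)²` does not increase as
long as the source vanishes where `p > t`. Testing the equation with `w u_t` leaves the flux `-b u_t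
∇u · ∇w`. Since `|∇w| ≤ 2 max(p - t, 0) √(c/b)`, the loss caused by `∂_t w = -2 max(p - t, 0)`
absorbs this flux by completing a square, and damping only helps. If the data vanish where `p > 0`,
the energy tends to 0 as `t → 0+`. So `u_t = 0` where `p > t`, and integrating in time gives `u = 0`
there.

The natural choice `p = d` is unbounded, whereas multipliers and test functions need a bounded
weight of compact support. It is replaced by the positive part of `d - d²/(2L) - η`. Its slope in
`d` has modulus at most 1 on the region where it is positive, and this region is bounded because (*)
forces `q → ∞`. Letting `L → ∞` and `η → 0` recovers `d`.

A weak solution cannot be tested with `w u_t`, as `u_t` need not have a gradient in `L²`. The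
estimate is therefore run for averages over `[t, t + δ]`. The average of `u_t` is a difference
quotient of `u`, hence lies in `H¹`, and the average of `∇u` is differentiable in time
(`WeakEquation.increment`, `energy_average_le`). The margin `η` leaves room for `δ ≤ η`: the
averaged source still vanishes where `p > t`. Then `δ → 0` (`IsSolution.ae_eq_zero_of_weight`).

Part (i) integrates the lower bound of `√(c/b)` given by the power bounds. Finally (*) turns the
region `q(|x|) > t + q(R)` into the stated exterior of a ball. -/

noncomputable section

namespace DampedWave

open scoped Convolution BoundedContinuousFunction

variable {n : ℕ} {F : Type*} [NormedAddCommGroup F] [InnerProductSpace ℝ F]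

/-! ### Multiplication operators on `L²` -/

/-- Multiplication of `L²` functions by bounded continuous functions. -/
def mulL (n : ℕ) (F : Type*) [NormedAddCommGroup F] [InnerProductSpace ℝ F] :
    (E n →ᵇ ℝ) →L[ℝ] Lp F 2 (volume : Measure (E n)) →L[ℝ] Lp F 2 (volume : Measure (E n)) :=
  LinearMap.mkContinuous₂
    (LinearMap.mk₂ ℝ
      (fun (m : E n →ᵇ ℝ) (f : Lp F 2 (volume : Measure (E n))) =>
        ((Lp.memLp f).smul (p := ⊤) (r := 2) (memLp_top_of_bound
          m.continuous.aestronglyMeasurable ‖m‖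
          (Eventually.of_forall m.norm_coe_le_norm))).toLp (⇑m • ⇑f))
      (by
        intro m₁ m₂ f
        rw [← MemLp.toLp_add]
        refine MemLp.toLp_congr _ _ (Eventually.of_forall fun x => ?_)
        simp [add_smul])
      (by
        intro r m f
        rw [← MemLp.toLp_const_smul]
        refine MemLp.toLp_congr _ _ (Eventually.of_forall fun x => ?_)
        simp [mul_smul])
      (by
        intro m f g
        rw [← MemLp.toLp_add]
        refine MemLp.toLp_congr _ _ ?_
        filter_upwards [Lp.coeFn_add f g] with x hx
        simp only [Pi.smul_apply', Pi.add_apply]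
        rw [hx, Pi.add_apply, smul_add])
      (by
        intro r m f
        rw [← MemLp.toLp_const_smul]
        refine MemLp.toLp_congr _ _ ?_
        filter_upwards [Lp.coeFn_smul r f] with x hx
        simp only [Pi.smul_apply', Pi.smul_apply]
        rw [hx, Pi.smul_apply, smul_comm]))
    1
    (by
      intro m f
      rw [one_mul]
      simp only [LinearMap.mk₂_apply]
      refine Lp.norm_le_mul_norm_of_ae_le_mul ?_
      have hm : MemLp (⇑m • ⇑f) 2 (volume : Measure (E n)) :=
        (Lp.memLp f).smul (p := ⊤) (r := 2) (memLp_top_of_bound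
          m.continuous.aestronglyMeasurable ‖m‖ (Eventually.of_forall m.norm_coe_le_norm))
      filter_upwards [hm.coeFn_toLp] with x hx
      rw [hx, Pi.smul_apply', norm_smul]
      exact mul_le_mul_of_nonneg_right (m.norm_coe_le_norm x) (norm_nonneg _))

theorem coeFn_mulL (m : E n →ᵇ ℝ) (f : Lp F 2 (volume : Measure (E n))) :
    mulL n F m f =ᵐ[volume] fun x => m x • f x := by
  simp only [mulL, LinearMap.mkContinuous₂_apply, LinearMap.mk₂_apply]
  exact MemLp.coeFn_toLp _

theorem inner_mulL (m : E n →ᵇ ℝ) (f g : Lp F 2 (volume : Measure (E n))) :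
    inner ℝ (mulL n F m f) g = ∫ x, m x * inner ℝ (f x) (g x) := by
  rw [L2.inner_def]
  refine integral_congr_ae ?_
  filter_upwards [coeFn_mulL m f] with x hx
  rw [hx, real_inner_smul_left]

theorem inner_mulL_comm (m : E n →ᵇ ℝ) (f g : Lp F 2 (volume : Measure (E n))) :
    inner ℝ (mulL n F m f) g = inner ℝ f (mulL n F m g) := by
  rw [real_inner_comm (mulL n F m g), inner_mulL, inner_mulL]
  simp only [real_inner_comm]

theorem mulL_mul (m₁ m₂ : E n →ᵇ ℝ) (f : Lp F 2 (volume : Measure (E n))) :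
    mulL n F (m₁ * m₂) f = mulL n F m₁ (mulL n F m₂ f) := by
  apply Lp.ext
  filter_upwards [coeFn_mulL (m₁ * m₂) f, coeFn_mulL m₁ (mulL n F m₂ f), coeFn_mulL m₂ f]
    with x h1 h2 h3
  rw [h1, h2, h3, smul_smul]
  rfl

theorem mulL_eq_zero {m : E n →ᵇ ℝ} {f : Lp F 2 (volume : Measure (E n))}
    (h : ∀ᵐ x, m x ≠ 0 → f x = 0) : mulL n F m f = 0 := by
  apply Lp.ext
  filter_upwards [coeFn_mulL m f, Lp.coeFn_zero F 2 (volume : Measure (E n)), h] with x h1 h2 h3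
  rw [h1, h2]
  by_cases hx : m x = 0
  · simp [hx]
  · simp [h3 hx]

/-- A continuous function agrees with a bounded one on a given ball. -/
theorem exists_boundedContinuous_eqOn {f : E n → ℝ} (hf : Continuous f) (r : ℝ) :
    ∃ g : E n →ᵇ ℝ, ∀ x, ‖x‖ ≤ r → g x = f x := by
  obtain ⟨C, hC⟩ := (isCompact_closedBall (0 : E n) r).exists_bound_of_continuousOn hf.continuousOn
  -- Truncation at level `|C|`; for negative `r` the ball is empty and `C` may be negative.
  refine ⟨BoundedContinuousFunction.ofNormedAddCommGroup (fun x => max (-|C|) (min (f x) |C|))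
    (by fun_prop) |C| ?_, ?_⟩
  · intro x
    rw [Real.norm_eq_abs, abs_le]
    have := abs_nonneg C
    exact ⟨le_max_left _ _, max_le (by linarith) (min_le_right _ _)⟩
  · intro x hx
    have h1 := hC x (by simpa using hx)
    rw [Real.norm_eq_abs] at h1
    have h2 := abs_le.1 (h1.trans (le_abs_self C))
    simp [h2.1, h2.2]

/-! ### Mollification and weak convergence in `L²` -/

/-- Translations act continuously on `L²`. -/
theorem continuous_inner_translate (X g : Lp F 2 (volume : Measure (E n))) :
    Continuous fun y : E n => ∫ x, (inner ℝ (X x) (g (x - y)) : ℝ) := by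
  have hmp : ∀ y : E n, MeasurePreserving (fun x : E n => x - y) volume volume :=
    fun y => measurePreserving_sub_right volume y
  have key : Continuous fun y : E n => Lp.compMeasurePreserving (fun x : E n => x - y) (hmp y) g := by
    let c : C(E n, C(E n, E n)) :=
      (ContinuousMap.mk (fun a : E n × E n => a.2 - a.1) (by fun_prop)).curry
    exact Continuous.compMeasurePreservingLp (g := c) continuous_const c.continuous
      (fun y => hmp y) (by norm_num)
  have h2 : (fun y : E n => ∫ x, (inner ℝ (X x) (g (x - y)) : ℝ)) =
      fun y => inner ℝ X (Lp.compMeasurePreserving (fun x : E n => x - y) (hmp y) g) := by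
    funext y
    rw [L2.inner_def]
    refine integral_congr_ae ?_
    filter_upwards [Lp.coeFn_compMeasurePreserving g (hmp y)] with x hx
    rw [hx]
    rfl
  rw [h2]
  exact continuous_const.inner key

theorem integrable_inner_Lp (X g : Lp F 2 (volume : Measure (E n))) :
    Integrable fun x => (inner ℝ (X x) (g x) : ℝ) := L2.integrable_inner X g

/-- The bound is uniform in `y`, by Cauchy–Schwarz and translation invariance; this supplies the
domination for Fubini below. -/
theorem integrable_inner_translate (X g : Lp F 2 (volume : Measure (E n))) (y : E n) :
    Integrable (fun x => (inner ℝ (X x) (g (x - y)) : ℝ)) ∧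
      ∫ x, ‖(inner ℝ (X x) (g (x - y)) : ℝ)‖ ≤ ‖X‖ * ‖g‖ := by
  have hmp : MeasurePreserving (fun x : E n => x - y) volume volume :=
    measurePreserving_sub_right volume y
  set g' := Lp.compMeasurePreserving (fun x : E n => x - y) hmp g with hg'
  have h1 := Lp.coeFn_compMeasurePreserving g hmp
  have h2 : ∀ᵐ x, (inner ℝ (X x) (g (x - y)) : ℝ) = inner ℝ (X x) (g' x) := by
    filter_upwards [h1] with x hx
    rw [hg', hx]
    rfl
  refine ⟨(integrable_inner_Lp X g').congr (by filter_upwards [h2] with x hx using hx.symm), ?_⟩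
  have hn : ‖g'‖ = ‖g‖ := Lp.norm_compMeasurePreserving g hmp
  calc ∫ x, ‖(inner ℝ (X x) (g (x - y)) : ℝ)‖
      ≤ ∫ x, ‖X x‖ * ‖g' x‖ := by
        refine integral_mono_of_nonneg (Eventually.of_forall fun _ => norm_nonneg _) ?_ ?_
        · have := integrable_inner_Lp (F := ℝ) ((Lp.memLp X).norm.toLp _) ((Lp.memLp g').norm.toLp _)
          refine this.congr ?_
          filter_upwards [(Lp.memLp X).norm.coeFn_toLp, (Lp.memLp g').norm.coeFn_toLp] with x e1 e2
          rw [e1, e2]; simp [mul_comm]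
        · filter_upwards [h2] with x hx
          rw [hx]; exact norm_inner_le_norm _ _
    _ = inner ℝ ((Lp.memLp X).norm.toLp _) ((Lp.memLp g').norm.toLp _) := by
        rw [L2.inner_def]
        refine integral_congr_ae ?_
        filter_upwards [(Lp.memLp X).norm.coeFn_toLp, (Lp.memLp g').norm.coeFn_toLp] with x e1 e2
        rw [e1, e2]; simp [mul_comm]
    _ ≤ ‖(Lp.memLp X).norm.toLp _‖ * ‖(Lp.memLp g').norm.toLp _‖ := real_inner_le_norm _ _
    _ = ‖X‖ * ‖g‖ := by
        rw [← hn, Lp.norm_toLp, Lp.norm_toLp, eLpNorm_norm, eLpNorm_norm, ← Lp.norm_def,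
          ← Lp.norm_def]

/-- Fubini. It reduces weak convergence of mollifications to continuity at `0` of the correlation on
the right. -/
theorem integral_inner_convolution [CompleteSpace F] {ρ : E n → ℝ} (hρ : Continuous ρ)
    (hρc : HasCompactSupport ρ) (X g : Lp F 2 (volume : Measure (E n))) :
    ∫ x, (inner ℝ (X x) ((ρ ⋆[ContinuousLinearMap.lsmul ℝ ℝ, volume] g) x) : ℝ) =
      ∫ y, ρ y * ∫ x, (inner ℝ (X x) (g (x - y)) : ℝ) := by
  have hloc : LocallyIntegrable g (volume : Measure (E n)) :=
    (Lp.memLp g).locallyIntegrable (by norm_num)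
  have hex := hρc.convolutionExists_left (ContinuousLinearMap.lsmul ℝ ℝ) hρ hloc
  have h1 : ∀ x, (inner ℝ (X x) ((ρ ⋆[ContinuousLinearMap.lsmul ℝ ℝ, volume] g) x) : ℝ) =
      ∫ y, ρ y * inner ℝ (X x) (g (x - y)) := by
    intro x
    rw [convolution_def, ← integral_inner (hex x)]
    simp [real_inner_smul_right]
  simp_rw [h1, ← integral_const_mul]
  refine integral_integral_swap ?_
  have hm : AEStronglyMeasurable (fun z : E n × E n => ρ z.2 * inner ℝ (X z.1) (g (z.1 - z.2)))
      (volume.prod volume) := by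
    refine (hρ.comp continuous_snd).aestronglyMeasurable.mul ?_
    refine AEStronglyMeasurable.inner ?_ ?_
    · exact (Lp.aestronglyMeasurable X).comp_fst
    · exact (Lp.aestronglyMeasurable g).comp_quasiMeasurePreserving
        (quasiMeasurePreserving_sub_of_right_invariant volume volume)
  refine (integrable_prod_iff' hm).2 ⟨?_, ?_⟩
  · exact Eventually.of_forall fun y => (integrable_inner_translate X g y).1.const_mul (ρ y)
  · have hi : Integrable (fun y => |ρ y| * (‖X‖ * ‖g‖)) (volume : Measure (E n)) :=
      ((hρ.integrable_of_hasCompactSupport hρc).abs).mul_const _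
    refine hi.mono' hm.norm.prod_swap.integral_prod_right' (Eventually.of_forall fun y => ?_)
    rw [Real.norm_of_nonneg (integral_nonneg fun _ => norm_nonneg _)]
    simp_rw [norm_mul]
    rw [integral_const_mul, Real.norm_eq_abs]
    exact mul_le_mul_of_nonneg_left (integrable_inner_translate X g y).2 (abs_nonneg _)

/-- Bump functions of outer radius `1 / (k + 1)`. -/
def bump (G : Type*) [NormedAddCommGroup G] (k : ℕ) : ContDiffBump (0 : G) where
  rIn := 1 / (2 * ((k : ℝ) + 1))
  rOut := 1 / ((k : ℝ) + 1)
  rIn_pos := by positivity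
  rIn_lt_rOut := by
    have : (0 : ℝ) < (k : ℝ) + 1 := by positivity
    apply one_div_lt_one_div_of_lt this; linarith

theorem tendsto_bump_rOut (G : Type*) [NormedAddCommGroup G] :
    Tendsto (fun k => (bump G k).rOut) atTop (𝓝 0) :=
  tendsto_one_div_add_atTop_nhds_zero_nat

theorem bump_rOut_le_one (G : Type*) [NormedAddCommGroup G] (k : ℕ) : (bump G k).rOut ≤ 1 := by
  change 1 / ((k : ℝ) + 1) ≤ 1
  rw [div_le_one (by positivity)]
  have : (0 : ℝ) ≤ k := by positivity
  linarith

/-- Mollifications converge weakly in `L²`. -/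
theorem tendsto_integral_inner_mollify [CompleteSpace F] (X g : Lp F 2 (volume : Measure (E n))) :
    Tendsto (fun k => ∫ x, (inner ℝ (X x) ((((bump (E n) k).normed volume)
      ⋆[ContinuousLinearMap.lsmul ℝ ℝ, volume] g) x) : ℝ)) atTop
      (𝓝 (∫ x, (inner ℝ (X x) (g x) : ℝ))) := by
  have hc := continuous_inner_translate X g
  -- The correlation is reflected, so that convolving it with the bump and evaluating at `0` gives
  -- the integral of bump times correlation.
  have := ContDiffBump.convolution_tendsto_right_of_continuous (μ := (volume : Measure (E n)))
    (φ := bump (E n)) (tendsto_bump_rOut (E n))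
    (hc.comp continuous_neg) 0
  simp only [Function.comp_apply, neg_zero, sub_zero] at this
  refine this.congr fun k => ?_
  rw [integral_inner_convolution (bump (E n) k).continuous_normed
    (bump (E n) k).hasCompactSupport_normed]
  rw [convolution_def]
  simp

/-! ### Calculus of weak gradients -/

theorem inner_gradient (φ : E n → ℝ) (x v : E n) : inner ℝ (∇ φ x) v = fderiv ℝ φ x v := by
  simp [gradient]

theorem norm_gradient (φ : E n → ℝ) (x : E n) : ‖∇ φ x‖ = ‖fderiv ℝ φ x‖ := by
  simp [gradient]

theorem continuous_gradient {φ : E n → ℝ} (h : ContDiff ℝ 1 φ) : Continuous (∇ φ) :=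
  (InnerProductSpace.toDual ℝ (E n)).symm.continuous.comp (h.continuous_fderiv one_ne_zero)

theorem hasCompactSupport_gradient {φ : E n → ℝ} (h : HasCompactSupport φ) :
    HasCompactSupport (∇ φ) :=
  (h.fderiv (𝕜 := ℝ)).comp_left (g := (InnerProductSpace.toDual ℝ (E n)).symm) (map_zero _)

theorem hasCompactSupport_of_norm {F : Type*} [Zero F] {φ : E n → F} {r : ℝ}
    (h : ∀ x, r < ‖x‖ → φ x = 0) : HasCompactSupport φ :=
  HasCompactSupport.intro (isCompact_closedBall (0 : E n) r) fun x hx => h x (by simpa using hx)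

theorem locallyIntegrable_Lp {F : Type*} [NormedAddCommGroup F]
    (f : Lp F 2 (volume : Measure (E n))) : LocallyIntegrable f volume :=
  (Lp.memLp f).locallyIntegrable (by norm_num)

/-- The scalar form of the definition of the weak gradient. -/
theorem isWeakGradient_iff {f : L2 n} {g : L2Vec n} :
    IsWeakGradient f g ↔ ∀ φ : E n → ℝ, ContDiff ℝ ∞ φ → HasCompactSupport φ → ∀ v : E n,
      ∫ x, f x * fderiv ℝ φ x v = - ∫ x, φ x * inner ℝ (g x) v := by
  refine forall_congr' fun φ => forall_congr' fun hφ => forall_congr' fun hc => ?_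
  have hφ1 : ContDiff ℝ 1 φ := hφ.of_le (by exact_mod_cast le_top)
  have h1 : Integrable fun x => f x • ∇ φ x :=
    (locallyIntegrable_Lp f).integrable_smul_right_of_hasCompactSupport
      (continuous_gradient hφ1) (hasCompactSupport_gradient hc)
  have h2 : Integrable fun x => φ x • g x :=
    (locallyIntegrable_Lp g).integrable_smul_left_of_hasCompactSupport hφ.continuous hc
  have e1 : ∀ v : E n, inner ℝ v (∫ x, f x • ∇ φ x) = ∫ x, f x * fderiv ℝ φ x v := fun v => by
    rw [← integral_inner h1]
    refine integral_congr_ae (Eventually.of_forall fun x => ?_)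
    simp only [real_inner_smul_right]
    rw [real_inner_comm, inner_gradient]
  have e2 : ∀ v : E n, inner ℝ v (- ∫ x, φ x • g x) = - ∫ x, φ x * inner ℝ (g x) v := fun v => by
    rw [inner_neg_right, ← integral_inner h2]
    simp only [real_inner_smul_right, real_inner_comm]
  constructor
  · intro h v
    rw [← e1, ← e2, h]
  · intro h
    refine ext_inner_left ℝ fun v => ?_
    rw [e1, e2, h]

/-- The gradient of a mollification is the mollification of the weak gradient. -/
theorem gradient_convolution {f : L2 n} {g : L2Vec n} (hfg : IsWeakGradient f g) {ρ : E n → ℝ}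
    (hρ : ContDiff ℝ ∞ ρ) (hc : HasCompactSupport ρ) (x : E n) :
    ∇ (ρ ⋆[ContinuousLinearMap.lsmul ℝ ℝ, volume] f) x =
      (ρ ⋆[ContinuousLinearMap.lsmul ℝ ℝ, volume] g) x := by
  have hρ1 : ContDiff ℝ 1 ρ := hρ.of_le (by exact_mod_cast le_top)
  refine ext_inner_right ℝ fun v => ?_
  rw [inner_gradient, (hc.hasFDerivAt_convolution_left (ContinuousLinearMap.lsmul ℝ ℝ) hρ1
    (locallyIntegrable_Lp f) x).fderiv]
  have hshift : ContDiff ℝ ∞ fun y => ρ (x - y) := hρ.comp (by fun_prop)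
  have hshiftc : HasCompactSupport fun y => ρ (x - y) :=
    hc.comp_homeomorph (Homeomorph.subLeft x)
  -- The test function is the reflected kernel `y ↦ ρ (x - y)`; reflection supplies the sign that
  -- cancels the minus of the definition.
  have key := isWeakGradient_iff.1 hfg _ hshift hshiftc v
  have hd : ∀ y, fderiv ℝ (fun y => ρ (x - y)) y v = - fderiv ℝ ρ (x - y) v := by
    intro y
    have h1 : HasFDerivAt ρ (fderiv ℝ ρ (x - y)) (x - y) :=
      (hρ1.differentiable one_ne_zero _).hasFDerivAt
    have := h1.comp y ((hasFDerivAt_id y).const_sub x)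
    have h3 := this.fderiv
    change fderiv ℝ (fun y => ρ (x - y)) y = _ at h3
    rw [h3]
    simp
  have hex := (hc.fderiv (𝕜 := ℝ)).convolutionExists_left
    ((ContinuousLinearMap.lsmul ℝ ℝ : ℝ →L[ℝ] ℝ →L[ℝ] ℝ).precompL (E n))
    (hρ1.continuous_fderiv one_ne_zero) (locallyIntegrable_Lp f) x
  have hint : Integrable fun y => ρ y • g (x - y) :=
    hc.convolutionExists_left (ContinuousLinearMap.lsmul ℝ ℝ) hρ.continuous
      (locallyIntegrable_Lp g) x
  rw [convolution_def, ContinuousLinearMap.integral_apply hex, convolution_def]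
  simp only [ContinuousLinearMap.lsmul_apply]
  rw [real_inner_comm, ← integral_inner hint]
  have e1 : ∫ t, ((ContinuousLinearMap.lsmul ℝ ℝ : ℝ →L[ℝ] ℝ →L[ℝ] ℝ).precompL (E n)
      (fderiv ℝ ρ t) (f (x - t))) v = ∫ y, f y * fderiv ℝ ρ (x - y) v := by
    rw [← integral_sub_left_eq_self (fun y => f y * fderiv ℝ ρ (x - y) v) volume x]
    simp [ContinuousLinearMap.precompL_apply, mul_comm]
  have e2 : ∫ t, (inner ℝ v (ρ t • g (x - t)) : ℝ) = ∫ y, ρ (x - y) * inner ℝ (g y) v := by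
    rw [← integral_sub_left_eq_self (fun y => ρ (x - y) * inner ℝ (g y) v) volume x]
    simp [real_inner_smul_right, real_inner_comm]
  rw [e1, e2]
  simp only [hd, mul_neg, integral_neg, neg_inj] at key
  exact key

/-- Compactly supported elements of `H¹` are weak limits of test functions. -/
theorem IsWeakGradient.exists_smooth_approx {f : L2 n} {g : L2Vec n} (hfg : IsWeakGradient f g)
    {r : ℝ} (hf : ∀ᵐ x, r < ‖x‖ → f x = 0) :
    ∃ ψ : ℕ → E n → ℝ, (∀ k, ContDiff ℝ ∞ (ψ k)) ∧ (∀ k x, r + 1 < ‖x‖ → ψ k x = 0) ∧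
      (∀ X : L2 n, Tendsto (fun k => ∫ x, X x * ψ k x) atTop (𝓝 (∫ x, X x * f x))) ∧
      (∀ Y : L2Vec n, Tendsto (fun k => ∫ x, (inner ℝ (Y x) (∇ (ψ k) x) : ℝ)) atTop
        (𝓝 (∫ x, (inner ℝ (Y x) (g x) : ℝ)))) := by
  refine ⟨fun k => ((bump (E n) k).normed volume) ⋆[ContinuousLinearMap.lsmul ℝ ℝ, volume] f,
    fun k => ?_, fun k x hx => ?_, fun X => ?_, fun Y => ?_⟩
  · exact (bump (E n) k).hasCompactSupport_normed.contDiff_convolution_left _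
      (bump (E n) k).contDiff_normed (locallyIntegrable_Lp f)
  · change (((bump (E n) k).normed volume) ⋆[ContinuousLinearMap.lsmul ℝ ℝ, volume] f) x = 0
    rw [convolution_def]
    refine integral_eq_zero_of_ae ?_
    have := (Measure.measurePreserving_sub_left (volume : Measure (E n)) x).quasiMeasurePreserving.ae hf
    filter_upwards [this] with y hy
    by_cases h : ‖y‖ < (bump (E n) k).rOut
    · have h1 : ‖x‖ ≤ ‖x - y‖ + ‖y‖ := by simpa using norm_add_le (x - y) y
      have h2 := bump_rOut_le_one (E n) k
      simp [hy (by linarith)]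
    · have : y ∉ Function.support ((bump (E n) k).normed volume) := by
        rw [ContDiffBump.support_normed_eq]
        simpa using h
      simp [Function.notMem_support.1 this]
  · have := tendsto_integral_inner_mollify X f
    simpa [mul_comm] using this
  · have := tendsto_integral_inner_mollify Y g
    refine this.congr fun k => integral_congr_ae (Eventually.of_forall fun x => ?_)
    simp only
    rw [gradient_convolution hfg (bump (E n) k).contDiff_normed
      (bump (E n) k).hasCompactSupport_normed x]

theorem memLp_of_hasCompactSupport {F : Type*} [NormedAddCommGroup F] {ζ : E n → F}
    (hζ : Continuous ζ) (hc : HasCompactSupport ζ) : MemLp ζ 2 (volume : Measure (E n)) :=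
  hζ.memLp_of_hasCompactSupport hc

/-- The classical gradient of a compactly supported `C¹` function is its weak gradient. -/
theorem isWeakGradient_toLp {ζ : E n → ℝ} (hζ : ContDiff ℝ 1 ζ) (hc : HasCompactSupport ζ) :
    IsWeakGradient ((memLp_of_hasCompactSupport hζ.continuous hc).toLp ζ)
      ((memLp_of_hasCompactSupport (continuous_gradient hζ) (hasCompactSupport_gradient hc)).toLp
        (∇ ζ)) := by
  refine isWeakGradient_iff.2 fun φ hφ hφc v => ?_
  have hφ1 : ContDiff ℝ 1 φ := hφ.of_le (by exact_mod_cast le_top)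
  have e1 : ∀ ξ : E n → ℝ, ContDiff ℝ 1 ξ → Continuous fun x => fderiv ℝ ξ x v :=
    fun ξ h => (h.continuous_fderiv one_ne_zero).clm_apply continuous_const
  have := integral_mul_fderiv_eq_neg_fderiv_mul_of_integrable (μ := (volume : Measure (E n)))
    (f := ζ) (g := φ) (v := v)
    (((e1 ζ hζ).mul hφ.continuous).integrable_of_hasCompactSupport hφc.mul_left)
    ((hζ.continuous.mul (e1 φ hφ1)).integrable_of_hasCompactSupport hc.mul_right)
    ((hζ.continuous.mul hφ.continuous).integrable_of_hasCompactSupport hc.mul_right)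
    (fun x _ => hζ.differentiable one_ne_zero x) (fun x _ => hφ1.differentiable one_ne_zero x)
  have h1 : ∫ x, (memLp_of_hasCompactSupport hζ.continuous hc).toLp ζ x * fderiv ℝ φ x v =
      ∫ x, ζ x * fderiv ℝ φ x v := by
    refine integral_congr_ae ?_
    filter_upwards [(memLp_of_hasCompactSupport hζ.continuous hc).coeFn_toLp] with x hx
    rw [hx]
  rw [h1, this]
  congr 1
  refine integral_congr_ae ?_
  filter_upwards [(memLp_of_hasCompactSupport (continuous_gradient hζ)
    (hasCompactSupport_gradient hc)).coeFn_toLp] with x hx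
  rw [hx, inner_gradient, mul_comm]

/-- The weak gradient may be tested with compactly supported `C¹` functions. -/
theorem IsWeakGradient.integral_fderiv {f : L2 n} {g : L2Vec n} (hfg : IsWeakGradient f g)
    {ζ : E n → ℝ} (hζ : ContDiff ℝ 1 ζ) (hc : HasCompactSupport ζ) (v : E n) :
    ∫ x, f x * fderiv ℝ ζ x v = - ∫ x, ζ x * inner ℝ (g x) v := by
  obtain ⟨r, hr⟩ : ∃ r, ∀ x, r < ‖x‖ → ζ x = 0 := by
    obtain ⟨r, hr⟩ := hc.isCompact.isBounded.subset_closedBall (0 : E n)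
    refine ⟨r, fun x hx => ?_⟩
    by_contra h
    have := hr (subset_tsupport _ h)
    simp at this
    linarith
  have hz := (memLp_of_hasCompactSupport hζ.continuous hc).coeFn_toLp
  have hgz := (memLp_of_hasCompactSupport (continuous_gradient hζ)
    (hasCompactSupport_gradient hc)).coeFn_toLp
  -- Mollifying `ζ` makes it smooth; both sides pass to the limit, being pairings with the fixed
  -- `L²` functions `f v` and `⟨g, v⟩`.
  obtain ⟨ψ, hψ, hψ0, hX, hY⟩ := (isWeakGradient_toLp hζ hc).exists_smooth_approx (r := r)
    (by filter_upwards [hz] with x hx h; rw [hx, hr x h])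
  have hmY : MemLp (fun x => f x • v) 2 (volume : Measure (E n)) := by
    refine (Lp.memLp f).of_le_mul (c := ‖v‖) ?_ (Eventually.of_forall fun x => ?_)
    · exact (Lp.aestronglyMeasurable f).smul_const v
    · rw [norm_smul, mul_comm]
  have hmX : MemLp (fun x => (inner ℝ (g x) v : ℝ)) 2 (volume : Measure (E n)) :=
    (Lp.memLp g).inner_const v
  have h1 := hY (hmY.toLp _)
  have h2 := (hX (hmX.toLp _)).neg
  have e1 : ∀ χ : E n → E n, ∫ x, (inner ℝ (hmY.toLp _ x) (χ x) : ℝ) =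
      ∫ x, f x * inner ℝ (χ x) v := fun χ => by
    refine integral_congr_ae ?_
    filter_upwards [hmY.coeFn_toLp] with x hx
    rw [hx, real_inner_smul_left, real_inner_comm]
  have e2 : ∀ χ : E n → ℝ, ∫ x, hmX.toLp _ x * χ x = ∫ x, χ x * inner ℝ (g x) v := fun χ => by
    refine integral_congr_ae ?_
    filter_upwards [hmX.coeFn_toLp] with x hx
    rw [hx, mul_comm]
  simp only [e1, e2, inner_gradient] at h1 h2
  have h3 : (fun k => ∫ x, f x * fderiv ℝ (ψ k) x v) =
      fun k => - ∫ x, ψ k x * inner ℝ (g x) v := by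
    funext k
    exact isWeakGradient_iff.1 hfg _ (hψ k) (hasCompactSupport_of_norm (hψ0 k)) v
  rw [h3] at h1
  have h4 := tendsto_nhds_unique h1 h2
  rw [integral_congr_ae (g := fun x => f x * fderiv ℝ ζ x v) (by
    filter_upwards [hgz] with x hx
    rw [hx, inner_gradient])] at h4
  rw [h4, integral_congr_ae (g := fun x => ζ x * inner ℝ (g x) v)]
  filter_upwards [hz] with x hx
  rw [hx]

/-- The product rule for a compactly supported `C¹` factor. -/
theorem IsWeakGradient.mul {f f' : L2 n} {g g' : L2Vec n} (hfg : IsWeakGradient f g)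
    {w : E n → ℝ} (hw : ContDiff ℝ 1 w) (hc : HasCompactSupport w)
    (hf' : f' =ᵐ[volume] fun x => w x * f x)
    (hg' : g' =ᵐ[volume] fun x => w x • g x + f x • ∇ w x) : IsWeakGradient f' g' := by
  refine isWeakGradient_iff.2 fun φ hφ hφc v => ?_
  have hφ1 : ContDiff ℝ 1 φ := hφ.of_le (by exact_mod_cast le_top)
  have e1 : ∀ ξ : E n → ℝ, ContDiff ℝ 1 ξ → Continuous fun x => fderiv ℝ ξ x v :=
    fun ξ h => (h.continuous_fderiv one_ne_zero).clm_apply continuous_const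
  -- The test function `φ w` is only `C¹`, hence the extension of the class of test functions above.
  have key := hfg.integral_fderiv (hφ1.mul hw) (hφc.mul_right (f' := w)) v
  have hd : ∀ x, fderiv ℝ (fun x => φ x * w x) x v =
      φ x * fderiv ℝ w x v + w x * fderiv ℝ φ x v := fun x => by
    rw [fderiv_fun_mul (hφ1.differentiable one_ne_zero x) (hw.differentiable one_ne_zero x)]
    simp
  have i1 : Integrable fun x => f x * (φ x * fderiv ℝ w x v) :=
    (locallyIntegrable_Lp f).integrable_smul_right_of_hasCompactSupport
      (hφ.continuous.mul (e1 w hw)) hφc.mul_right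
  have i2 : Integrable fun x => f x * (w x * fderiv ℝ φ x v) :=
    (locallyIntegrable_Lp f).integrable_smul_right_of_hasCompactSupport
      (hw.continuous.mul (e1 φ hφ1)) hc.mul_right
  have i3 : Integrable fun x => φ x * w x * inner ℝ (g x) v :=
    (((locallyIntegrable_Lp g).integrable_smul_left_of_hasCompactSupport
      (hφ.continuous.mul hw.continuous) hφc.mul_right).inner_const v).congr
      (Eventually.of_forall fun x => by simp [real_inner_smul_left])
  have a1 : ∫ x, f x * fderiv ℝ (fun x => φ x * w x) x v =
      (∫ x, f x * (φ x * fderiv ℝ w x v)) + ∫ x, f x * (w x * fderiv ℝ φ x v) := by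
    rw [← integral_add i1 i2]
    simp only [hd, mul_add]
  have a2 : ∫ x, f' x * fderiv ℝ φ x v = ∫ x, f x * (w x * fderiv ℝ φ x v) := by
    refine integral_congr_ae ?_
    filter_upwards [hf'] with x hx
    rw [hx]; ring
  have a3 : ∫ x, φ x * inner ℝ (g' x) v =
      (∫ x, φ x * w x * inner ℝ (g x) v) + ∫ x, f x * (φ x * fderiv ℝ w x v) := by
    rw [← integral_add i3 i1]
    refine integral_congr_ae ?_
    filter_upwards [hg'] with x hx
    rw [hx, inner_add_left, real_inner_smul_left, real_inner_smul_left, inner_gradient]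
    ring
  change ∫ x, f x * fderiv ℝ (fun x => φ x * w x) x v = - ∫ x, φ x * w x * inner ℝ (g x) v at key
  rw [a1] at key
  rw [a2, a3]
  linarith

/-- An identity `∫ X ψ + ∫ Y · ∇ψ = 0` for test functions extends to products `w f` of a `C¹`
cutoff and an `H¹` function. -/
theorem IsWeakGradient.integral_test {f : L2 n} {g : L2Vec n} (hfg : IsWeakGradient f g)
    {w : E n → ℝ} (hw : ContDiff ℝ 1 w) {r : ℝ} (hwr : ∀ x, r < ‖x‖ → w x = 0)
    {X : L2 n} {Y : L2Vec n}
    (h : ∀ ψ : E n → ℝ, ContDiff ℝ ∞ ψ → (∀ x, r + 1 < ‖x‖ → ψ x = 0) →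
      (∫ x, X x * ψ x) + ∫ x, (inner ℝ (Y x) (∇ ψ x) : ℝ) = 0) :
    ∃ (f' : L2 n) (g' : L2Vec n), f' =ᵐ[volume] (fun x => w x * f x) ∧
      g' =ᵐ[volume] (fun x => w x • g x + f x • ∇ w x) ∧ inner ℝ X f' + inner ℝ Y g' = 0 := by
  have hc := hasCompactSupport_of_norm hwr
  obtain ⟨C, hC⟩ := hw.continuous.bounded_above_of_compact_support hc
  obtain ⟨C', hC'⟩ := (continuous_gradient hw).bounded_above_of_compact_support
    (hasCompactSupport_gradient hc)
  have m1 : MemLp (fun x => w x * f x) 2 (volume : Measure (E n)) := by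
    refine (Lp.memLp f).of_le_mul (c := C)
      (hw.continuous.aestronglyMeasurable.mul (Lp.aestronglyMeasurable f))
      (Eventually.of_forall fun x => ?_)
    rw [norm_mul]
    exact mul_le_mul_of_nonneg_right (hC x) (norm_nonneg _)
  have m2 : MemLp (fun x => w x • g x) 2 (volume : Measure (E n)) := by
    refine (Lp.memLp g).of_le_mul (c := C)
      (hw.continuous.aestronglyMeasurable.smul (Lp.aestronglyMeasurable g))
      (Eventually.of_forall fun x => ?_)
    rw [norm_smul]
    exact mul_le_mul_of_nonneg_right (hC x) (norm_nonneg _)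
  have m3 : MemLp (fun x => f x • ∇ w x) 2 (volume : Measure (E n)) := by
    refine (Lp.memLp f).of_le_mul (c := C')
      ((Lp.aestronglyMeasurable f).smul (continuous_gradient hw).aestronglyMeasurable)
      (Eventually.of_forall fun x => ?_)
    rw [norm_smul, mul_comm]
    exact mul_le_mul_of_nonneg_right (hC' x) (norm_nonneg _)
  have m4 : MemLp (fun x => w x • g x + f x • ∇ w x) 2 (volume : Measure (E n)) := m2.add m3
  -- Mollification enlarges the support by at most 1, which is why the identity is assumed for test
  -- functions on the ball of radius `r + 1`.
  obtain ⟨ψ, hψ, hψ0, hX, hY⟩ := (hfg.mul hw hc m1.coeFn_toLp m4.coeFn_toLp).exists_smooth_approx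
    (r := r) (by filter_upwards [m1.coeFn_toLp] with x hx h; rw [hx, hwr x h, zero_mul])
  have := (hX X).add (hY Y)
  simp only [h _ (hψ _) (hψ0 _)] at this
  have h0 := tendsto_nhds_unique this tendsto_const_nhds
  refine ⟨_, _, m1.coeFn_toLp, m4.coeFn_toLp, ?_⟩
  rw [L2.inner_def, L2.inner_def, ← h0]
  simp [mul_comm]

/-- The weak gradient vanishes on open sets where the function does. -/
theorem IsWeakGradient.ae_eq_zero {f : L2 n} {g : L2Vec n} (hfg : IsWeakGradient f g)
    {U : Set (E n)} (hU : IsOpen U) (hf : ∀ᵐ x, x ∈ U → f x = 0) : ∀ᵐ x, x ∈ U → g x = 0 := by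
  refine hU.ae_eq_zero_of_integral_contDiff_smul_eq_zero
    ((locallyIntegrable_Lp g).locallyIntegrableOn U) fun φ hφ hc hs => ?_
  rw [← neg_eq_zero, ← hfg φ hφ hc]
  refine integral_eq_zero_of_ae ?_
  filter_upwards [hf] with x hx
  by_cases h : x ∈ tsupport φ
  · simp [hx (hs h)]
  · have : fderiv ℝ φ x = 0 := by
      by_contra h'
      exact h (support_fderiv_subset ℝ h')
    simp [gradient, this]

/-- Weak gradients are compatible with linear combinations. -/
theorem IsWeakGradient.smul_sub {f₁ f₂ : L2 n} {g₁ g₂ : L2Vec n} (h₁ : IsWeakGradient f₁ g₁)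
    (h₂ : IsWeakGradient f₂ g₂) (r : ℝ) : IsWeakGradient (r • (f₁ - f₂)) (r • (g₁ - g₂)) := by
  intro φ hφ hc
  have hφ1 : ContDiff ℝ 1 φ := hφ.of_le (by exact_mod_cast le_top)
  have i1 : ∀ f : L2 n, Integrable fun x => f x • ∇ φ x := fun f =>
    (locallyIntegrable_Lp f).integrable_smul_right_of_hasCompactSupport
      (continuous_gradient hφ1) (hasCompactSupport_gradient hc)
  have i2 : ∀ g : L2Vec n, Integrable fun x => φ x • g x := fun g =>
    (locallyIntegrable_Lp g).integrable_smul_left_of_hasCompactSupport hφ.continuous hc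
  have e1 : ∫ x, (r • (f₁ - f₂) : L2 n) x • ∇ φ x =
      r • ((∫ x, f₁ x • ∇ φ x) - ∫ x, f₂ x • ∇ φ x) := by
    rw [← integral_sub (i1 f₁) (i1 f₂), ← integral_smul]
    refine integral_congr_ae ?_
    filter_upwards [Lp.coeFn_smul r (f₁ - f₂), Lp.coeFn_sub f₁ f₂] with x h1 h2
    rw [h1, Pi.smul_apply, h2, Pi.sub_apply, smul_assoc, sub_smul]
  have e2 : ∫ x, φ x • (r • (g₁ - g₂) : L2Vec n) x =
      r • ((∫ x, φ x • g₁ x) - ∫ x, φ x • g₂ x) := by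
    rw [← integral_sub (i2 g₁) (i2 g₂), ← integral_smul]
    refine integral_congr_ae ?_
    filter_upwards [Lp.coeFn_smul r (g₁ - g₂), Lp.coeFn_sub g₁ g₂] with x h1 h2
    rw [h1, Pi.smul_apply, h2, Pi.sub_apply, smul_comm, _root_.smul_sub]
  rw [e1, e2, h₁ φ hφ hc, h₂ φ hφ hc]
  module

/-! ### The du Bois-Reymond lemma in time -/

theorem continuous_mul_of_tsupport_subset {K θ : ℝ → ℝ} {s : Set ℝ} (hs : IsOpen s)
    (hK : ContinuousOn K s) (hθ : Continuous θ) (h : tsupport θ ⊆ s) :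
    Continuous fun t => K t * θ t := by
  refine continuous_of_tsupport fun t ht => ?_
  have : t ∈ s := h (closure_mono (fun x hx => by
    intro h0
    exact hx (by simp [h0])) ht)
  exact (hK.continuousAt (hs.mem_nhds this)).mul hθ.continuousAt

/-- The derivative at `x` of a mollification of `K` is `K` tested against a reflected kernel, so it
vanishes as soon as that kernel is supported in `Ioi a`. The mollifications are constant there, and
converge pointwise to `K`. -/
theorem eq_of_integral_mul_deriv_eq_zero_of_continuous {K : ℝ → ℝ} {a : ℝ} (hK : Continuous K)
    (h : ∀ θ : ℝ → ℝ, ContDiff ℝ ∞ θ → HasCompactSupport θ → tsupport θ ⊆ Ioi a →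
      ∫ τ, K τ * deriv θ τ = 0) {s t : ℝ} (hs : a < s) (ht : a < t) : K s = K t := by
  have hlim := fun x => ContDiffBump.convolution_tendsto_right_of_continuous
    (μ := (volume : Measure ℝ)) (φ := bump ℝ) (tendsto_bump_rOut ℝ) hK x
  refine tendsto_nhds_unique (hlim s) ((hlim t).congr' ?_)
  have hev : ∀ᶠ k in atTop, (bump ℝ k).rOut < min s t - a :=
    (tendsto_bump_rOut ℝ).eventually_lt_const (by simp [hs, ht])
  filter_upwards [hev] with k hk
  set ρ := (bump ℝ k).normed volume with hρ
  have hρs : ContDiff ℝ ∞ ρ := (bump ℝ k).contDiff_normed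
  have hρ1 : ContDiff ℝ 1 ρ := hρs.of_le (by exact_mod_cast le_top)
  have hρc : HasCompactSupport ρ := (bump ℝ k).hasCompactSupport_normed
  have hd : ∀ x, HasDerivAt (ρ ⋆[ContinuousLinearMap.lsmul ℝ ℝ, volume] K)
      ((deriv ρ ⋆[ContinuousLinearMap.lsmul ℝ ℝ, volume] K) x) x := fun x =>
    hρc.hasDerivAt_convolution_left _ hρ1 hK.locallyIntegrable x
  have hz : ∀ x ∈ Ioi (a + (bump ℝ k).rOut),
      deriv (ρ ⋆[ContinuousLinearMap.lsmul ℝ ℝ, volume] K) x = 0 := by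
    intro x hx
    rw [(hd x).deriv, convolution_def]
    have h1 := h (fun τ => ρ (x - τ)) (hρs.comp (by fun_prop))
      (hρc.comp_homeomorph (Homeomorph.subLeft x)) ?_
    · rw [← integral_sub_left_eq_self _ volume x]
      have h2 : ∀ τ, deriv (fun τ => ρ (x - τ)) τ = - deriv ρ (x - τ) := fun τ =>
        deriv_comp_const_sub ..
      simp only [h2, mul_neg, integral_neg, neg_eq_zero] at h1
      simpa [mul_comm] using h1
    · intro τ hτ
      have h3 : τ ∈ (fun τ => x - τ) ⁻¹' (tsupport ρ) :=
        tsupport_comp_subset_preimage ρ (f := fun τ => x - τ) (by fun_prop) hτ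
      rw [mem_preimage, hρ, ContDiffBump.tsupport_normed_eq, mem_closedBall_zero_iff,
        Real.norm_eq_abs, abs_le] at h3
      rw [mem_Ioi] at hx ⊢
      linarith [h3.2]
  refine isOpen_Ioi.is_const_of_deriv_eq_zero isPreconnected_Ioi
    (fun x _ => (hd x).differentiableAt.differentiableWithinAt) hz ?_ ?_
  · have := min_le_right s t
    rw [mem_Ioi]; linarith
  · have := min_le_left s t
    rw [mem_Ioi]; linarith

/-- The lemma of du Bois-Reymond on a half line. -/
theorem eq_of_integral_mul_deriv_eq_zero {K : ℝ → ℝ} {a : ℝ} (hK : ContinuousOn K (Ioi a))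
    (h : ∀ θ : ℝ → ℝ, ContDiff ℝ ∞ θ → HasCompactSupport θ → tsupport θ ⊆ Ioi a →
      ∫ τ, K τ * deriv θ τ = 0) {s t : ℝ} (hs : a < s) (ht : a < t) : K s = K t := by
  obtain ⟨a', h1, h2⟩ := exists_between (lt_min hs ht)
  have h3 := h2.trans_le (min_le_left s t)
  have h4 := h2.trans_le (min_le_right s t)
  -- Freezing `K` to the left of some `a' > a` makes it globally continuous without changing it near
  -- `s`, `t` or the supports of the test functions in `Ioi a'`.
  have hc : Continuous fun τ => K (max τ a') :=
    hK.comp_continuous (by fun_prop) fun τ => h1.trans_le (le_max_right _ _)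
  have := eq_of_integral_mul_deriv_eq_zero_of_continuous hc (a := a') (fun θ hθ hθc hθs => ?_) h3 h4
  · simpa [max_eq_left h3.le, max_eq_left h4.le] using this
  · rw [← h θ hθ hθc (hθs.trans (Ioi_subset_Ioi h1.le))]
    refine integral_congr_ae (Eventually.of_forall fun τ => ?_)
    simp only
    by_cases hτ : τ ∈ tsupport θ
    · rw [max_eq_left (hθs hτ).le]
    · have : deriv θ τ = 0 := by
        by_contra h'
        exact hτ (support_deriv_subset h')
      simp [this]

/-! ### The equation integrated in time -/

theorem H1.continuous_fn : Continuous (H1.fn : H1 n → L2 n) :=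
  (WithLp.prod_continuous_ofLp 2 (L2 n) (L2Vec n)).fst.comp continuous_subtype_val

theorem H1.continuous_grad : Continuous (H1.grad : H1 n → L2Vec n) :=
  (WithLp.prod_continuous_ofLp 2 (L2 n) (L2Vec n)).snd.comp continuous_subtype_val

theorem inner_toLp {F : Type*} [NormedAddCommGroup F] [InnerProductSpace ℝ F]
    (f : Lp F 2 (volume : Measure (E n))) {ψ : E n → F} (hψ : MemLp ψ 2 volume) :
    inner ℝ f (hψ.toLp ψ) = ∫ x, (inner ℝ (f x) (ψ x) : ℝ) := by
  rw [L2.inner_def]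
  refine integral_congr_ae ?_
  filter_upwards [hψ.coeFn_toLp] with x hx
  rw [hx]

theorem inner_mulL_toLp {F : Type*} [NormedAddCommGroup F] [InnerProductSpace ℝ F]
    (m : E n →ᵇ ℝ) (f : Lp F 2 (volume : Measure (E n))) {ψ : E n → F} (hψ : MemLp ψ 2 volume) :
    inner ℝ (mulL n F m f) (hψ.toLp ψ) = ∫ x, m x * inner ℝ (f x) (ψ x) := by
  rw [inner_mulL]
  refine integral_congr_ae ?_
  filter_upwards [hψ.coeFn_toLp] with x hx
  rw [hx]

theorem gradient_const_mul {ψ : E n → ℝ} (hψ : Differentiable ℝ ψ) (r : ℝ) (x : E n) :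
    ∇ (fun y => r * ψ y) x = r • ∇ ψ x := by
  simp [gradient, fderiv_const_mul (hψ x)]

theorem gradient_eq_zero_of_norm {ψ : E n → ℝ} {r : ℝ} (h : ∀ x, r < ‖x‖ → ψ x = 0) (x : E n)
    (hx : r < ‖x‖) : ∇ ψ x = 0 := by
  have : ψ =ᶠ[𝓝 x] fun _ => 0 := by
    filter_upwards [(isOpen_lt continuous_const continuous_norm).mem_nhds hx] with y hy
    exact h y hy
  simp [gradient, this.fderiv_eq]

/-- The coefficients may be unbounded and then do not act on `L²`; against a test function on a ball
they can be exchanged for bounded ones. -/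
theorem integral_coeff_mul_test {M : E n →ᵇ ℝ} {m : E n → ℝ} {r : ℝ}
    (hM : ∀ x, ‖x‖ ≤ r → M x = m x) {F : Type*} [NormedAddCommGroup F] [InnerProductSpace ℝ F]
    {ψ : E n → F} (hψ : MemLp ψ 2 volume) (hψr : ∀ x, r < ‖x‖ → ψ x = 0)
    (f : Lp F 2 (volume : Measure (E n))) :
    Integrable (fun x => m x * inner ℝ (f x) (ψ x)) ∧
      inner ℝ (mulL n F M f) (hψ.toLp ψ) = ∫ x, m x * inner ℝ (f x) (ψ x) := by
  have e : ∀ x, M x * inner ℝ (f x) (ψ x) = m x * inner ℝ (f x) (ψ x) := fun x => by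
    by_cases hx : ‖x‖ ≤ r
    · rw [hM x hx]
    · simp [hψr x (not_le.1 hx)]
  constructor
  · refine (integrable_inner_Lp (mulL n F M f) (hψ.toLp ψ)).congr ?_
    filter_upwards [coeFn_mulL M f, hψ.coeFn_toLp] with x h1 h2
    rw [h1, h2, ← e, real_inner_smul_left]
  · rw [inner_mulL_toLp]
    simp only [e]

/-- The weak equation tested with a product `θ(t) ψ(x)`. -/
theorem WeakEquation.integral_product {a b c : E n → ℝ} {h : ℝ → L2 n} {u : ℝ → H1 n}
    {v : ℝ → L2 n} (hw : WeakEquation a b c h u v)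
    {A B C : E n →ᵇ ℝ} {r : ℝ} (hA : ∀ x, ‖x‖ ≤ r → A x = a x) (hB : ∀ x, ‖x‖ ≤ r → B x = b x)
    (hC : ∀ x, ‖x‖ ≤ r → C x = c x)
    {ψ : E n → ℝ} (hψ : ContDiff ℝ ∞ ψ) (hψr : ∀ x, r < ‖x‖ → ψ x = 0)
    (m1 : MemLp ψ 2 volume) (m2 : MemLp (∇ ψ) 2 volume)
    {θ : ℝ → ℝ} (hθ : ContDiff ℝ ∞ θ) (hθc : HasCompactSupport θ) (hθs : tsupport θ ⊆ Ioi 0) :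
    ∫ τ, (-(inner ℝ (mulL n ℝ C (v τ)) (m1.toLp ψ) * deriv θ τ)
        + (inner ℝ (mulL n (E n) B (u τ).grad) (m2.toLp (∇ ψ))
          + inner ℝ (mulL n ℝ A (v τ)) (m1.toLp ψ)) * θ τ) =
      ∫ τ, inner ℝ (h τ) (m1.toLp ψ) * θ τ := by
  have hψ1 : ContDiff ℝ 1 ψ := hψ.of_le (by exact_mod_cast le_top)
  have hθ1 : ContDiff ℝ 1 θ := hθ.of_le (by exact_mod_cast le_top)
  have hψc := hasCompactSupport_of_norm hψr
  have hgr := gradient_eq_zero_of_norm hψr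
  have hθ's : tsupport (deriv θ) ⊆ Ioi 0 := (tsupport_deriv_subset (𝕜 := ℝ)).trans hθs
  have hφ : ContDiff ℝ ∞ (fun p : ℝ × E n => θ p.1 * ψ p.2) := by fun_prop
  have hφc : HasCompactSupport (fun p : ℝ × E n => θ p.1 * ψ p.2) := by
    refine HasCompactSupport.intro (hθc.isCompact.prod hψc.isCompact) fun p hp => ?_
    rw [mem_prod, not_and_or] at hp
    rcases hp with hp | hp
    · simp [image_eq_zero_of_notMem_tsupport hp]
    · simp [image_eq_zero_of_notMem_tsupport hp]
  have hφs : tsupport (fun p : ℝ × E n => θ p.1 * ψ p.2) ⊆ {p | 0 < p.1} := by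
    have h1 : tsupport (fun p : ℝ × E n => θ p.1 * ψ p.2) ⊆ Prod.fst ⁻¹' tsupport θ := by
      refine closure_minimal (fun p hp => ?_) ((isClosed_tsupport θ).preimage continuous_fst)
      exact subset_tsupport _ (left_ne_zero_of_mul hp)
    exact fun p hp => hθs (h1 hp)
  have weak : ∫ t in Ioi (0 : ℝ), ∫ x : E n,
        (-(c x * v t x * deriv (fun s => θ s * ψ x) t)
          + b x * inner ℝ ((u t).grad x) (∇ (fun y => θ t * ψ y) x)
          + a x * v t x * (θ t * ψ x))
      = ∫ t in Ioi (0 : ℝ), ∫ x : E n, h t x * (θ t * ψ x) := hw _ hφ hφc hφs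
  have zθ : ∀ τ, τ ∉ Ioi (0 : ℝ) → θ τ = 0 := fun τ hτ =>
    image_eq_zero_of_notMem_tsupport fun h' => hτ (hθs h')
  have zθ' : ∀ τ, τ ∉ Ioi (0 : ℝ) → deriv θ τ = 0 := fun τ hτ =>
    image_eq_zero_of_notMem_tsupport fun h' => hτ (hθ's h')
  have eL : ∀ τ, (∫ x : E n, (-(c x * v τ x * deriv (fun s => θ s * ψ x) τ)
        + b x * inner ℝ ((u τ).grad x) (∇ (fun y => θ τ * ψ y) x)
        + a x * v τ x * (θ τ * ψ x))) =
      -(inner ℝ (mulL n ℝ C (v τ)) (m1.toLp ψ) * deriv θ τ)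
        + (inner ℝ (mulL n (E n) B (u τ).grad) (m2.toLp (∇ ψ))
          + inner ℝ (mulL n ℝ A (v τ)) (m1.toLp ψ)) * θ τ := by
    intro τ
    obtain ⟨p2, p1⟩ := integral_coeff_mul_test hC m1 hψr (v τ)
    obtain ⟨p4, p3⟩ := integral_coeff_mul_test hA m1 hψr (v τ)
    obtain ⟨p6, p5⟩ := integral_coeff_mul_test hB m2 hgr (u τ).grad
    have q2 : Integrable (fun x => -(c x * inner ℝ (v τ x) (ψ x) * deriv θ τ)) :=
      (p2.mul_const (deriv θ τ)).neg
    have q6 : Integrable (fun x => b x * inner ℝ ((u τ).grad x) (∇ ψ x) * θ τ) := p6.mul_const _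
    have q4 : Integrable (fun x => a x * inner ℝ (v τ x) (ψ x) * θ τ) := p4.mul_const _
    have q7 : Integrable (fun x => b x * inner ℝ ((u τ).grad x) (∇ ψ x) * θ τ
      + a x * inner ℝ (v τ x) (ψ x) * θ τ) := q6.add q4
    rw [p1, p3, p5, add_mul, ← integral_mul_const, ← integral_mul_const, ← integral_mul_const,
      ← integral_neg, ← integral_add q6 q4, ← integral_add q2 q7]
    refine integral_congr_ae (Eventually.of_forall fun x => ?_)
    have hd : deriv (fun s => θ s * ψ x) τ = deriv θ τ * ψ x :=
      deriv_mul_const (hθ1.differentiable one_ne_zero τ) _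
    simp only [hd, gradient_const_mul (hψ1.differentiable one_ne_zero), real_inner_smul_right,
      RCLike.inner_apply, conj_trivial]
    ring
  have eR : ∀ τ, (∫ x : E n, h τ x * (θ τ * ψ x)) = inner ℝ (h τ) (m1.toLp ψ) * θ τ := by
    intro τ
    rw [inner_toLp, ← integral_mul_const]
    refine integral_congr_ae (Eventually.of_forall fun x => ?_)
    simp only [RCLike.inner_apply, conj_trivial]
    ring
  simp only [eL, eR] at weak
  rwa [setIntegral_eq_integral_of_forall_compl_eq_zero (fun τ hτ => by
    simp only [zθ τ hτ, zθ' τ hτ, mul_zero, neg_zero, add_zero]),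
    setIntegral_eq_integral_of_forall_compl_eq_zero (fun τ hτ => by
      simp only [zθ τ hτ, mul_zero])] at weak

/-- A weak first order equation `P' + N = 0` on a half line, with `Q' = N`, says that `P + Q` is
constant. -/
theorem add_eq_add_of_weak_deriv {P Q N S : ℝ → ℝ} {a : ℝ} (hP : ContinuousOn P (Ioi a))
    (hN : ContinuousOn N (Ioi a)) (hS : ContinuousOn S (Ioi a))
    (hQ : ∀ τ, a < τ → HasDerivAt Q (N τ) τ)
    (h : ∀ θ : ℝ → ℝ, ContDiff ℝ ∞ θ → HasCompactSupport θ → tsupport θ ⊆ Ioi a →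
      ∫ τ, (-(P τ * deriv θ τ) + (N τ + S τ) * θ τ) = ∫ τ, S τ * θ τ)
    {s t : ℝ} (hs : a < s) (ht : a < t) : P s + Q s = P t + Q t := by
  have hQc : ContinuousOn Q (Ioi a) := fun τ hτ => (hQ τ hτ).continuousAt.continuousWithinAt
  refine eq_of_integral_mul_deriv_eq_zero (K := fun τ => P τ + Q τ) (hP.add hQc)
    (fun θ hθ hθc hθs => ?_) hs ht
  have weak := h θ hθ hθc hθs
  have hθ1 : ContDiff ℝ 1 θ := hθ.of_le (by exact_mod_cast le_top)
  have hθ' : Continuous (deriv θ) := hθ1.continuous_deriv le_rfl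
  have hθ's : tsupport (deriv θ) ⊆ Ioi a := (tsupport_deriv_subset (𝕜 := ℝ)).trans hθs
  have int : ∀ {K χ : ℝ → ℝ}, ContinuousOn K (Ioi a) → Continuous χ → HasCompactSupport χ →
      tsupport χ ⊆ Ioi a → Integrable fun τ => K τ * χ τ := fun hK hχ hχc hχs =>
    (continuous_mul_of_tsupport_subset isOpen_Ioi hK hχ hχs).integrable_of_hasCompactSupport
      hχc.mul_left
  have i1 := int hP hθ' hθc.deriv hθ's
  have i2 := int hQc hθ' hθc.deriv hθ's
  have i3 := int hN hθ.continuous hθc hθs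
  have i4 := int hQc hθ.continuous hθc hθs
  have i5 := int hS hθ.continuous hθc hθs
  -- `Q` is an honest primitive of `N`, so integration by parts puts the lower order terms under
  -- `deriv θ` as well.
  have ibp : ∫ τ, Q τ * deriv θ τ = - ∫ τ, N τ * θ τ := by
    have := integral_bilinear_hasLineDerivAt_right_eq_neg_left_of_integrable
      (μ := (volume : Measure ℝ)) (f := Q) (f' := N) (g := θ) (g' := deriv θ) (v := (1 : ℝ))
      (B := ContinuousLinearMap.mul ℝ ℝ) i3 i2 i4
      (fun x hx => by simpa using (hQ x (hθs hx)).hasFDerivAt.hasLineDerivAt 1)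
      (fun x _ => by
        simpa using (hθ1.differentiable one_ne_zero x).hasDerivAt.hasFDerivAt.hasLineDerivAt 1)
    simpa using this
  have i7 : Integrable fun τ => - (P τ * deriv θ τ) := i1.neg
  have i6 : Integrable fun τ => - (P τ * deriv θ τ) + N τ * θ τ := i7.add i3
  have e7 : ∫ τ, (P τ + Q τ) * deriv θ τ =
      (∫ τ, P τ * deriv θ τ) + ∫ τ, Q τ * deriv θ τ := by
    rw [← integral_add i1 i2]
    exact integral_congr_ae (Eventually.of_forall fun τ => add_mul _ _ _)
  have e8 : ∫ τ, (-(P τ * deriv θ τ) + (N τ + S τ) * θ τ) =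
      (-(∫ τ, P τ * deriv θ τ) + ∫ τ, N τ * θ τ) + ∫ τ, S τ * θ τ := by
    rw [← integral_neg, ← integral_add i7 i3, ← integral_add i6 i5]
    refine integral_congr_ae (Eventually.of_forall fun τ => ?_)
    simp only
    ring
  rw [e8] at weak
  rw [e7, ibp]
  linarith

set_option maxHeartbeats 1600000 in
/-- Increments in time of the weak equation, tested with functions of `x`. -/
theorem WeakEquation.increment {a b c : E n → ℝ} {h : ℝ → L2 n} {u : ℝ → H1 n} {v : ℝ → L2 n}
    (hw : WeakEquation a b c h u v) (hh : ContinuousOn h (Ioi 0)) (hu : ContinuousOn u (Ioi 0))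
    (hv : ContinuousOn v (Ioi 0)) (huv : ∀ t, 0 < t → HasDerivAt (fun s => (u s).fn) (v t) t)
    {I : ℝ → L2Vec n} (hI : ∀ t, 0 < t → HasDerivAt I (u t).grad t)
    {J : ℝ → L2 n} (hJ : ∀ t, 0 < t → HasDerivAt J (h t) t)
    {A B C : E n →ᵇ ℝ} {r : ℝ} (hA : ∀ x, ‖x‖ ≤ r → A x = a x) (hB : ∀ x, ‖x‖ ≤ r → B x = b x)
    (hC : ∀ x, ‖x‖ ≤ r → C x = c x) {s t : ℝ} (hs : 0 < s) (ht : 0 < t)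
    {ψ : E n → ℝ} (hψ : ContDiff ℝ ∞ ψ) (hψr : ∀ x, r < ‖x‖ → ψ x = 0) (κ : ℝ) :
    (∫ x, (mulL n ℝ C (κ • (v t - v s)) + mulL n ℝ A (κ • ((u t).fn - (u s).fn))
        - κ • (J t - J s) : L2 n) x * ψ x)
      + ∫ x, (inner ℝ ((mulL n (E n) B (κ • (I t - I s)) : L2Vec n) x) (∇ ψ x) : ℝ) = 0 := by
  have hψ1 : ContDiff ℝ 1 ψ := hψ.of_le (by exact_mod_cast le_top)
  have hψc := hasCompactSupport_of_norm hψr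
  have m1 : MemLp ψ 2 volume := memLp_of_hasCompactSupport hψ.continuous hψc
  have m2 : MemLp (∇ ψ) 2 volume := memLp_of_hasCompactSupport (continuous_gradient hψ1)
    (hasCompactSupport_gradient hψc)
  set Ψ : L2 n := m1.toLp ψ with hΨ
  set Ψ' : L2Vec n := m2.toLp (∇ ψ) with hΨ'
  have cgrad : ContinuousOn (fun t => (u t).grad) (Ioi 0) :=
    H1.continuous_grad.comp_continuousOn hu
  -- For fixed `ψ` the equation reads `P' + N = 0` weakly in time, and `Q' = N`. Hence `P + Q` is
  -- conserved; its increment times `κ` is the claim, with no second time derivative left.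
  let P : ℝ → ℝ := fun τ => inner ℝ (mulL n ℝ C (v τ)) Ψ
  let Q : ℝ → ℝ := fun τ => inner ℝ (mulL n ℝ A (u τ).fn) Ψ + inner ℝ (mulL n (E n) B (I τ)) Ψ'
    - inner ℝ (J τ) Ψ
  let N : ℝ → ℝ := fun τ => inner ℝ (mulL n ℝ A (v τ)) Ψ
    + inner ℝ (mulL n (E n) B (u τ).grad) Ψ' - inner ℝ (h τ) Ψ
  have hP : ContinuousOn P (Ioi 0) :=
    ((mulL n ℝ C).continuous.comp_continuousOn hv).inner continuousOn_const
  have hN : ContinuousOn N (Ioi 0) :=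
    ((((mulL n ℝ A).continuous.comp_continuousOn hv).inner continuousOn_const).add
      (((mulL n (E n) B).continuous.comp_continuousOn cgrad).inner continuousOn_const)).sub
      (hh.inner continuousOn_const)
  have hQ : ∀ τ, 0 < τ → HasDerivAt Q (N τ) τ := by
    intro τ hτ
    have d1 := ((mulL n ℝ A).hasFDerivAt.comp_hasDerivAt τ (huv τ hτ)).inner ℝ
      (hasDerivAt_const τ Ψ)
    have d2 := ((mulL n (E n) B).hasFDerivAt.comp_hasDerivAt τ (hI τ hτ)).inner ℝ
      (hasDerivAt_const τ Ψ')
    have d3 := (hJ τ hτ).inner ℝ (hasDerivAt_const τ Ψ)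
    have := (d1.add d2).sub d3
    simp only [inner_zero_right, zero_add] at this
    exact this
  have key : P s + Q s = P t + Q t := by
    refine add_eq_add_of_weak_deriv (S := fun τ => inner ℝ (h τ) Ψ) hP hN
      (hh.inner continuousOn_const) hQ (fun θ hθ hθc hθs => ?_) hs ht
    rw [← hw.integral_product hA hB hC hψ hψr m1 m2 hθ hθc hθs]
    refine integral_congr_ae (Eventually.of_forall fun τ => ?_)
    simp only [P, N]
    rw [hΨ, hΨ']
    ring
  have f1 : ∀ f : L2 n, ∫ x, f x * ψ x = inner ℝ f Ψ := fun f => by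
    rw [hΨ, inner_toLp]
    simp [mul_comm]
  rw [f1, ← inner_toLp _ m2]
  simp only [map_smul, map_sub, ← smul_add, ← _root_.smul_sub, inner_add_left, inner_sub_left,
    real_inner_smul_left]
  simp only [P, Q] at key
  rw [← hΨ']
  linear_combination (-κ) * key

/-! ### Weights and the weighted energy -/

/-- The positive part of `p - t`. -/
def excess (p : E n →ᵇ ℝ) (t : ℝ) : E n →ᵇ ℝ := (p - BoundedContinuousFunction.const _ t) ⊔ 0

/-- The time dependent weight `max (p - t) 0 ^ 2`. -/
def weight (p : E n →ᵇ ℝ) (t : ℝ) : E n →ᵇ ℝ := excess p t * excess p t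

theorem excess_apply (p : E n →ᵇ ℝ) (t : ℝ) (x : E n) : excess p t x = max (p x - t) 0 := rfl

theorem weight_apply (p : E n →ᵇ ℝ) (t : ℝ) (x : E n) : weight p t x = max (p x - t) 0 ^ 2 := by
  rw [sq]; rfl

theorem weight_eq_zero {p : E n →ᵇ ℝ} {t : ℝ} {x : E n} (h : p x ≤ t) : weight p t x = 0 := by
  rw [weight_apply, max_eq_right (by linarith)]; norm_num

theorem weight_pos {p : E n →ᵇ ℝ} {t : ℝ} {x : E n} (h : t < p x) : 0 < weight p t x := by
  rw [weight_apply, max_eq_left (by linarith)]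
  have : 0 < p x - t := by linarith
  positivity

/-- The derivative is in the sup norm: `y ↦ max y 0 ^ 2` has a 2-Lipschitz derivative, so the Taylor
remainder is at most `(s - t)²` uniformly in `x`. -/
theorem hasDerivAt_weight (p : E n →ᵇ ℝ) (t : ℝ) :
    HasDerivAt (weight p) ((-2 : ℝ) • excess p t) t := by
  have key : ∀ s, ‖weight p s - weight p t - (s - t) • ((-2 : ℝ) • excess p t)‖ ≤
      1 * ‖(s - t) ^ 2‖ := by
    intro s
    rw [one_mul, BoundedContinuousFunction.norm_le (norm_nonneg _)]
    intro x
    have e : (weight p s - weight p t - (s - t) • ((-2 : ℝ) • excess p t)) x =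
        max (p x - s) 0 ^ 2 - max (p x - t) 0 ^ 2 - (s - t) * (-2 * max (p x - t) 0) := by
      simp only [BoundedContinuousFunction.coe_sub, BoundedContinuousFunction.coe_smul,
        Pi.sub_apply, weight_apply, excess_apply, smul_eq_mul]
    rw [e, Real.norm_eq_abs, Real.norm_eq_abs, abs_of_nonneg (sq_nonneg (s - t)), abs_le]
    rcases le_total (p x - s) 0 with h1 | h1 <;> rcases le_total (p x - t) 0 with h2 | h2 <;>
      simp only [max_eq_left, max_eq_right, h1, h2] <;> constructor <;> nlinarith
  rw [hasDerivAt_iff_isLittleO]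
  refine (Asymptotics.IsBigO.of_bound 1 (Eventually.of_forall key)).trans_isLittleO ?_
  have h1 : (fun s : ℝ => s - t) =o[𝓝 t] fun _ => (1 : ℝ) := by
    rw [Asymptotics.isLittleO_one_iff]
    have : Tendsto (fun s : ℝ => s - t) (𝓝 t) (𝓝 (t - t)) := by
      exact (continuous_id.sub continuous_const).tendsto t
    simpa using this
  have := h1.mul_isBigO (Asymptotics.isBigO_refl (fun s : ℝ => s - t) (𝓝 t))
  simpa [sq] using this

theorem continuous_weight (p : E n →ᵇ ℝ) : Continuous (weight p) :=
  continuous_iff_continuousAt.2 fun t => (hasDerivAt_weight p t).continuousAt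

theorem hasDerivAt_inner_mulL {F : Type*} [NormedAddCommGroup F] [InnerProductSpace ℝ F]
    {M : ℝ → E n →ᵇ ℝ} {M' : E n →ᵇ ℝ} {f : ℝ → Lp F 2 (volume : Measure (E n))}
    {f' : Lp F 2 (volume : Measure (E n))} {t : ℝ} (hM : HasDerivAt M M' t)
    (hf : HasDerivAt f f' t) :
    HasDerivAt (fun t => (inner ℝ (mulL n F (M t) (f t)) (f t) : ℝ))
      (inner ℝ (mulL n F M' (f t)) (f t) + 2 * inner ℝ (mulL n F (M t) (f t)) f') t := by
  -- The product rule applies because `mulL` is bounded bilinear; symmetry of multiplication then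
  -- merges the two terms in `f'`.
  have h1 : HasDerivAt (fun t => mulL n F (M t) (f t)) (mulL n F (M t) f' + mulL n F M' (f t)) t :=
    (mulL n F).hasDerivAt_of_bilinear (fun _ => hM) (fun _ => hf)
  have h2 := h1.inner ℝ hf
  refine h2.congr_deriv ?_
  rw [inner_add_left, inner_mulL_comm (M t) f' (f t),
    real_inner_comm (mulL n F (M t) (f t)) f']
  ring

theorem tendsto_inner_mulL {F : Type*} [NormedAddCommGroup F] [InnerProductSpace ℝ F]
    {ι : Type*} {l : Filter ι} {M : ι → E n →ᵇ ℝ} {m : E n →ᵇ ℝ}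
    {φ : ι → Lp F 2 (volume : Measure (E n))} {f : Lp F 2 (volume : Measure (E n))}
    (hM : Tendsto M l (𝓝 m)) (hφ : Tendsto φ l (𝓝 f)) :
    Tendsto (fun i => (inner ℝ (mulL n F (M i) (φ i)) (φ i) : ℝ)) l
      (𝓝 (inner ℝ (mulL n F m f) f)) := by
  have hc : Continuous fun q : (E n →ᵇ ℝ) × Lp F 2 (volume : Measure (E n)) =>
      mulL n F q.1 q.2 := (mulL n F).continuous₂
  exact ((hc.tendsto (m, f)).comp (hM.prodMk_nhds hφ)).inner hφ

/-- The weighted energy. -/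
def energy (B C : E n →ᵇ ℝ) (p : E n →ᵇ ℝ) (t : ℝ) (f : L2 n) (g : L2Vec n) : ℝ :=
  2⁻¹ * (inner ℝ (mulL n ℝ (C * weight p t) f) f + inner ℝ (mulL n (E n) (B * weight p t) g) g)

theorem tendsto_energy {ι : Type*} {l : Filter ι} (B C p : E n →ᵇ ℝ) {τ : ι → ℝ} {t : ℝ}
    {φ : ι → L2 n} {f : L2 n} {γ : ι → L2Vec n} {g : L2Vec n} (hτ : Tendsto τ l (𝓝 t))
    (hφ : Tendsto φ l (𝓝 f)) (hγ : Tendsto γ l (𝓝 g)) :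
    Tendsto (fun i => energy B C p (τ i) (φ i) (γ i)) l (𝓝 (energy B C p t f g)) := by
  have hw := ((continuous_weight p).tendsto t).comp hτ
  have h1 := tendsto_inner_mulL (hw.const_mul C) hφ
  have h2 := tendsto_inner_mulL (hw.const_mul B) hγ
  exact (h1.add h2).const_mul _

/-- The dissipation inequality behind the energy estimate. -/
theorem dissipation_nonpos {a b c s V H : ℝ} {G D : E n} (ha : 0 ≤ a) (hb : 0 < b) (hc : 0 < c)
    (hs : 0 ≤ s) (hH : 0 < s → H = 0) (hD : ‖D‖ ≤ 2 * s * Real.sqrt (c / b)) :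
    -(s * (c * V ^ 2 + b * inner ℝ G G)) - s ^ 2 * a * V ^ 2 + s ^ 2 * H * V
      - b * V * inner ℝ G D ≤ 0 := by
  have h1 : s ^ 2 * H * V = 0 := by
    rcases hs.eq_or_lt with h | h
    · rw [← h]; ring
    · rw [hH h]; ring
  have h2 : |(inner ℝ G D : ℝ)| ≤ ‖G‖ * (2 * s * Real.sqrt (c / b)) :=
    (abs_real_inner_le_norm G D).trans (mul_le_mul_of_nonneg_left hD (norm_nonneg _))
  have h3 : -(b * V * inner ℝ G D) ≤ b * |V| * (‖G‖ * (2 * s * Real.sqrt (c / b))) := by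
    calc -(b * V * inner ℝ G D) ≤ |b * V * inner ℝ G D| := neg_le_abs _
      _ = b * |V| * |(inner ℝ G D : ℝ)| := by rw [abs_mul, abs_mul, abs_of_pos hb]
      _ ≤ _ := mul_le_mul_of_nonneg_left h2 (by positivity)
  set k := Real.sqrt (c / b) with hk
  have h4 : c = b * k ^ 2 := by
    rw [hk, Real.sq_sqrt (by positivity)]; field_simp
  have h5 : (inner ℝ G G : ℝ) = ‖G‖ ^ 2 := real_inner_self_eq_norm_sq G
  have h6 : V ^ 2 = |V| ^ 2 := (sq_abs V).symm
  have h7 : 0 ≤ s * b * (k * |V| - ‖G‖) ^ 2 := by positivity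
  have h8 : 0 ≤ s ^ 2 * a * V ^ 2 := by positivity
  rw [h1, h5]
  -- With `c = b k²` the energy loss minus the flux bound is a complete square.
  have h9 : s * (c * V ^ 2 + b * ‖G‖ ^ 2) - b * |V| * (‖G‖ * (2 * s * k)) =
      s * b * (k * |V| - ‖G‖) ^ 2 := by
    rw [h4, h6]; ring
  linarith

set_option maxHeartbeats 1600000 in
/-- The weighted energy of a regular solution decreases. -/
theorem energy_antitoneOn {A B C p : E n →ᵇ ℝ} {V V' H : ℝ → L2 n} {G G' : ℝ → L2Vec n} {r : ℝ}
    (hV : ∀ t, 0 < t → HasDerivAt V (V' t) t) (hG : ∀ t, 0 < t → HasDerivAt G (G' t) t)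
    (hVG : ∀ t, 0 < t → IsWeakGradient (V t) (G' t))
    (heq : ∀ t, 0 < t → ∀ ψ : E n → ℝ, ContDiff ℝ ∞ ψ → (∀ x, r + 1 < ‖x‖ → ψ x = 0) →
      (∫ x, (mulL n ℝ C (V' t) + mulL n ℝ A (V t) - H t : L2 n) x * ψ x)
        + ∫ x, (inner ℝ ((mulL n (E n) B (G t) : L2Vec n) x) (∇ ψ x) : ℝ) = 0)
    (hA : ∀ x, ‖x‖ ≤ r → 0 ≤ A x) (hB : ∀ x, ‖x‖ ≤ r → 0 < B x) (hC : ∀ x, ‖x‖ ≤ r → 0 < C x)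
    (hp : ∀ x, r < ‖x‖ → p x ≤ 0) (hw : ∀ t, 0 < t → ContDiff ℝ 1 (weight p t))
    (hD : ∀ t, 0 < t → ∀ x, ‖∇ (weight p t) x‖ ≤ 2 * excess p t x * Real.sqrt (C x / B x))
    (hH : ∀ t, 0 < t → ∀ᵐ x, t < p x → H t x = 0) :
    AntitoneOn (fun t => energy B C p t (V t) (G t)) (Ioi 0) := by
  have hd : ∀ t, 0 < t → HasDerivAt (fun t => energy B C p t (V t) (G t))
      (2⁻¹ * ((inner ℝ (mulL n ℝ (C * ((-2 : ℝ) • excess p t)) (V t)) (V t)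
          + 2 * inner ℝ (mulL n ℝ (C * weight p t) (V t)) (V' t))
        + (inner ℝ (mulL n (E n) (B * ((-2 : ℝ) • excess p t)) (G t)) (G t)
          + 2 * inner ℝ (mulL n (E n) (B * weight p t) (G t)) (G' t)))) t := by
    intro t ht
    have h1 := (hasDerivAt_weight p t).const_mul C
    have h2 := (hasDerivAt_weight p t).const_mul B
    exact ((hasDerivAt_inner_mulL h1 (hV t ht)).add
      (hasDerivAt_inner_mulL h2 (hG t ht))).const_mul _
  refine antitoneOn_of_deriv_nonpos (convex_Ioi 0)
    (fun t ht => (hd t ht).continuousAt.continuousWithinAt)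
    (fun t ht => (hd t (by simpa using ht)).differentiableAt.differentiableWithinAt)
    fun t ht => ?_
  rw [interior_Ioi, mem_Ioi] at ht
  rw [(hd t ht).deriv]
  -- The equation is tested with `weight p t · V`, legitimate because `V` has the weak gradient
  -- `G'`.
  obtain ⟨f', g', hf', hg', h0⟩ := (hVG t ht).integral_test (hw t ht) (r := r)
    (fun x hx => weight_eq_zero ((hp x hx).trans ht.le)) (heq t ht)
  set X : L2 n := mulL n ℝ C (V' t) + mulL n ℝ A (V t) - H t with hX
  set v₁ := mulL n ℝ (C * ((-2 : ℝ) • excess p t)) (V t) with hv₁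
  set v₂ := mulL n ℝ (C * weight p t) (V t) with hv₂
  set g₁ := mulL n (E n) (B * ((-2 : ℝ) • excess p t)) (G t) with hg₁
  set g₂ := mulL n (E n) (B * weight p t) (G t) with hg₂
  set Y := mulL n (E n) B (G t) with hY
  have i1 := (integrable_inner_Lp v₁ (V t)).const_mul 2⁻¹
  have i2 := integrable_inner_Lp v₂ (V' t)
  have i3 := (integrable_inner_Lp g₁ (G t)).const_mul 2⁻¹
  have i4 := integrable_inner_Lp g₂ (G' t)
  have i5 := integrable_inner_Lp X f'
  have i6 := integrable_inner_Lp Y g'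
  -- Subtracting the tested equation, which is zero, cancels all terms with `V'` and `G'`. What
  -- remains is the pointwise expression of `dissipation_nonpos`.
  have e : 2⁻¹ * ((inner ℝ v₁ (V t) + 2 * inner ℝ v₂ (V' t))
        + (inner ℝ g₁ (G t) + 2 * inner ℝ g₂ (G' t))) =
      ((2⁻¹ * inner ℝ v₁ (V t) + inner ℝ v₂ (V' t)) +
        (2⁻¹ * inner ℝ g₁ (G t) + inner ℝ g₂ (G' t))) - (inner ℝ X f' + inner ℝ Y g' : ℝ) := by
    rw [h0]; ring
  rw [e]
  simp only [L2.inner_def]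
  have j1 : Integrable (fun x => 2⁻¹ * inner ℝ (v₁ x) (V t x) + inner ℝ (v₂ x) (V' t x)) :=
    i1.add i2
  have j2 : Integrable (fun x => 2⁻¹ * inner ℝ (g₁ x) (G t x) + inner ℝ (g₂ x) (G' t x)) :=
    i3.add i4
  have j3 : Integrable (fun x => (inner ℝ (X x) (f' x) + inner ℝ (Y x) (g' x) : ℝ)) := i5.add i6
  have j4 : Integrable (fun x => (2⁻¹ * inner ℝ (v₁ x) (V t x) + inner ℝ (v₂ x) (V' t x))
      + (2⁻¹ * inner ℝ (g₁ x) (G t x) + inner ℝ (g₂ x) (G' t x))) := j1.add j2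
  rw [← integral_const_mul, ← integral_const_mul, ← integral_add i1 i2, ← integral_add i3 i4,
    ← integral_add j1 j2, ← integral_add i5 i6, ← integral_sub j4 j3]
  refine integral_nonpos_of_ae ?_
  filter_upwards [coeFn_mulL (C * ((-2 : ℝ) • excess p t)) (V t),
    coeFn_mulL (C * weight p t) (V t), coeFn_mulL (B * ((-2 : ℝ) • excess p t)) (G t),
    coeFn_mulL (B * weight p t) (G t), coeFn_mulL B (G t), hf', hg', hH t ht,
    Lp.coeFn_sub (mulL n ℝ C (V' t) + mulL n ℝ A (V t)) (H t),
    Lp.coeFn_add (mulL n ℝ C (V' t)) (mulL n ℝ A (V t)), coeFn_mulL C (V' t), coeFn_mulL A (V t)]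
    with x k1 k2 k3 k4 k5 k6 k7 k8 k9 k10 k11 k12
  have kX : X x = C x * V' t x + A x * V t x - H t x := by
    rw [hX, k9, Pi.sub_apply, k10, Pi.add_apply, k11, k12]; rfl
  have c1 : (C * ((-2 : ℝ) • excess p t)) x = C x * (-2 * excess p t x) := rfl
  have c2 : (B * ((-2 : ℝ) • excess p t)) x = B x * (-2 * excess p t x) := rfl
  have c3 : (C * weight p t) x = C x * (excess p t x * excess p t x) := rfl
  have c4 : (B * weight p t) x = B x * (excess p t x * excess p t x) := rfl
  have c5 : weight p t x = excess p t x * excess p t x := rfl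
  rw [c1] at k1
  rw [c3] at k2
  rw [c2] at k3
  rw [c4] at k4
  simp only [hv₁, hv₂, hg₁, hg₂, hY, k1, k2, k3, k4, k5, k6, k7, kX, c5, inner_add_right,
    real_inner_smul_left, real_inner_smul_right, RCLike.inner_apply, conj_trivial, smul_eq_mul,
    Pi.zero_apply]
  have hs : 0 ≤ excess p t x := le_max_right _ _
  have hs' : 0 < excess p t x → t < p x := fun h => by
    by_contra h'
    rw [excess_apply, max_eq_right (by linarith)] at h
    exact lt_irrefl _ h
  by_cases hx : ‖x‖ ≤ r
  · have := dissipation_nonpos (V := V t x) (H := H t x) (G := G t x) (hA x hx) (hB x hx)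
      (hC x hx) hs (fun h => k8 (hs' h)) (hD t ht x)
    nlinarith [this]
  -- Outside the ball the signs of `A`, `B`, `C` are unknown, but the weight and its gradient
  -- vanish.
  · have hz : excess p t x = 0 := by
      rw [excess_apply, max_eq_right (by linarith [hp x (not_le.1 hx)])]
    have hz' : ∇ (weight p t) x = 0 := by
      rw [← norm_le_zero_iff]
      simpa [hz] using hD t ht x
    rw [hz, hz']
    simp

/-! ### Propagation of zeros for a general weight -/

/-- If the derivative of `f` vanishes where `m ≠ 0`, then `m f` is constant. -/
theorem mulL_eq_of_deriv {F : Type*} [NormedAddCommGroup F] [InnerProductSpace ℝ F]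
    (m : E n →ᵇ ℝ) {f f' : ℝ → Lp F 2 (volume : Measure (E n))} {s t : ℝ} (hst : s ≤ t)
    (hf : ∀ τ ∈ Icc s t, HasDerivAt f (f' τ) τ) (hm : ∀ τ ∈ Icc s t, mulL n F m (f' τ) = 0) :
    mulL n F m (f t) = mulL n F m (f s) := by
  have hd : ∀ τ ∈ Icc s t, HasDerivAt (fun τ => mulL n F m (f τ)) 0 τ := fun τ hτ => by
    have := (mulL n F m).hasFDerivAt.comp_hasDerivAt τ (hf τ hτ)
    rw [hm τ hτ] at this
    exact this
  exact constant_of_has_deriv_right_zero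
    (fun τ hτ => (hd τ hτ).continuousAt.continuousWithinAt)
    (fun τ hτ => (hd τ (Ico_subset_Icc_self hτ)).hasDerivWithinAt) t (right_mem_Icc.2 hst)

/-- With its converse below, this encodes vanishing on `{t < p}` as one equation in `L²`, stable
under limits and derivatives in time, so no null sets depending on time have to be collected. -/
theorem ae_eq_zero_of_mulL_weight {F : Type*} [NormedAddCommGroup F] [InnerProductSpace ℝ F]
    {p : E n →ᵇ ℝ} {t : ℝ} {f : Lp F 2 (volume : Measure (E n))}
    (h : mulL n F (weight p t) f = 0) : ∀ᵐ x, t < p x → f x = 0 := by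
  have h1 := coeFn_mulL (weight p t) f
  rw [h] at h1
  filter_upwards [h1, Lp.coeFn_zero F 2 (volume : Measure (E n))] with x h2 h3 hx
  rw [h3, Pi.zero_apply] at h2
  exact (smul_eq_zero.1 h2.symm).resolve_left (weight_pos hx).ne'

theorem mulL_weight_eq_zero {F : Type*} [NormedAddCommGroup F] [InnerProductSpace ℝ F]
    {p : E n →ᵇ ℝ} {t : ℝ} {f : Lp F 2 (volume : Measure (E n))}
    (h : ∀ᵐ x, t < p x → f x = 0) : mulL n F (weight p t) f = 0 := by
  refine mulL_eq_zero ?_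
  filter_upwards [h] with x hx h0
  refine hx ?_
  by_contra h'
  exact h0 (weight_eq_zero (not_lt.1 h'))

theorem exists_primitive {F : Type*} [NormedAddCommGroup F] [NormedSpace ℝ F] [CompleteSpace F]
    {f : ℝ → F} (hf : ContinuousOn f (Ioi 0)) :
    ∃ I : ℝ → F, ∀ t, 0 < t → HasDerivAt I (f t) t := by
  -- The base point is 1, since `f` need not be integrable near 0.
  refine ⟨fun t => ∫ τ in (1 : ℝ)..t, f τ, fun t ht => ?_⟩
  refine intervalIntegral.integral_hasDerivAt_right ?_ ?_ (hf.continuousAt (Ioi_mem_nhds ht))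
  · refine (hf.mono fun τ hτ => ?_).intervalIntegrable
    exact (lt_min one_pos ht).trans_le hτ.1
  · exact hf.stronglyMeasurableAtFilter isOpen_Ioi t ht

theorem energy_eq_zero {B C p : E n →ᵇ ℝ} {t : ℝ} {f : L2 n} {g : L2Vec n}
    (hf : ∀ᵐ x, t < p x → f x = 0) (hg : ∀ᵐ x, t < p x → g x = 0) :
    energy B C p t f g = 0 := by
  rw [energy, mulL_mul, mulL_mul, mulL_weight_eq_zero hf, mulL_weight_eq_zero hg]
  simp

/-- A function of nonpositive energy vanishes where the weight does not. -/
theorem ae_eq_zero_of_energy_nonpos {B C p : E n →ᵇ ℝ} {t r : ℝ} (ht : 0 < t)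
    (hp : ∀ x, r < ‖x‖ → p x ≤ 0) (hB : ∀ x, ‖x‖ ≤ r → 0 < B x) (hC : ∀ x, ‖x‖ ≤ r → 0 < C x)
    {f : L2 n} {g : L2Vec n} (h : energy B C p t f g ≤ 0) : ∀ᵐ x, t < p x → f x = 0 := by
  have hpos : ∀ {M : E n →ᵇ ℝ}, (∀ x, ‖x‖ ≤ r → 0 < M x) → ∀ x, 0 ≤ (M * weight p t) x := by
    intro M hM x
    rw [BoundedContinuousFunction.mul_apply]
    by_cases hx : ‖x‖ ≤ r
    · refine mul_nonneg (hM x hx).le ?_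
      rw [weight_apply]; positivity
    · rw [weight_eq_zero ((hp x (not_le.1 hx)).trans ht.le), mul_zero]
  have hg0 : 0 ≤ (inner ℝ (mulL n (E n) (B * weight p t) g) g : ℝ) := by
    rw [inner_mulL]
    exact integral_nonneg fun x => mul_nonneg (hpos hB x) real_inner_self_nonneg
  have hf0 : (inner ℝ (mulL n ℝ (C * weight p t) f) f : ℝ) ≤ 0 := by
    rw [energy] at h
    linarith
  have hi : Integrable fun x => (C * weight p t) x * inner ℝ (f x) (f x) := by
    refine (integrable_inner_Lp (mulL n ℝ (C * weight p t) f) f).congr ?_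
    filter_upwards [coeFn_mulL (C * weight p t) f] with x hx
    rw [hx, real_inner_smul_left]
  rw [inner_mulL] at hf0
  have hnn : ∀ x, 0 ≤ (C * weight p t) x * inner ℝ (f x) (f x) := fun x =>
    mul_nonneg (hpos hC x) real_inner_self_nonneg
  have h0 := (integral_eq_zero_iff_of_nonneg hnn hi).1 (le_antisymm hf0 (integral_nonneg hnn))
  filter_upwards [h0] with x hx hxt
  have hxr : ‖x‖ ≤ r := by
    by_contra h'
    linarith [hp x (not_le.1 h')]
  have h1 : 0 < (C * weight p t) x := by
    rw [BoundedContinuousFunction.mul_apply]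
    exact mul_pos (hC x hxr) (weight_pos hxt)
  exact inner_self_eq_zero.1 ((mul_eq_zero.1 hx).resolve_left h1.ne')

theorem tendsto_difference_quotient {F : Type*} [NormedAddCommGroup F] [NormedSpace ℝ F]
    {f : ℝ → F} {f' : F} {t : ℝ} (h : HasDerivAt f f' t) :
    Tendsto (fun δ => δ⁻¹ • (f (t + δ) - f t)) (𝓝[>] 0) (𝓝 f') :=
  h.tendsto_slope_zero_right

theorem hasDerivAt_difference_quotient {F : Type*} [NormedAddCommGroup F] [NormedSpace ℝ F]
    {f f' : ℝ → F} (h : ∀ t, 0 < t → HasDerivAt f (f' t) t) {δ t : ℝ} (hδ : 0 < δ) (ht : 0 < t) :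
    HasDerivAt (fun t => δ⁻¹ • (f (t + δ) - f t)) (δ⁻¹ • (f' (t + δ) - f' t)) t :=
  (((h (t + δ) (by linarith)).comp_add_const t δ).sub (h t ht)).const_smul _

/-- The energy of the time averages of a solution decreases. -/
theorem energy_average_le {a b c : E n → ℝ} {h : ℝ → L2 n} {u : ℝ → H1 n} {v : ℝ → L2 n}
    (hwe : WeakEquation a b c h u v) (hh : ContinuousOn h (Ioi 0)) (hu : ContinuousOn u (Ioi 0))
    (hv : ContinuousOn v (Ioi 0)) (huv : ∀ t, 0 < t → HasDerivAt (fun s => (u s).fn) (v t) t)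
    {I : ℝ → L2Vec n} (hI : ∀ t, 0 < t → HasDerivAt I (u t).grad t)
    {A B C p : E n →ᵇ ℝ} {r : ℝ} (hA : ∀ x, ‖x‖ ≤ r + 1 → A x = a x)
    (hB : ∀ x, ‖x‖ ≤ r + 1 → B x = b x) (hC : ∀ x, ‖x‖ ≤ r + 1 → C x = c x)
    (ha : ∀ x, 0 ≤ a x) (hb : ∀ x, 0 < b x) (hc : ∀ x, 0 < c x)
    (hp : ∀ x, r < ‖x‖ → p x ≤ 0) (hw : ∀ t, 0 < t → ContDiff ℝ 1 (weight p t))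
    (hD : ∀ t, 0 < t → ∀ x, ‖∇ (weight p t) x‖ ≤ 2 * excess p t x * Real.sqrt (c x / b x))
    {δ : ℝ} (hδ : 0 < δ) (hhs : ∀ t, 0 < t → ∀ᵐ x, 0 < p x → t < p x + δ → h t x = 0)
    {s t : ℝ} (hs : 0 < s) (hst : s ≤ t) :
    energy B C p t (δ⁻¹ • ((u (t + δ)).fn - (u t).fn)) (δ⁻¹ • (I (t + δ) - I t)) ≤
      energy B C p s (δ⁻¹ • ((u (s + δ)).fn - (u s).fn)) (δ⁻¹ • (I (s + δ) - I s)) := by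
  obtain ⟨J, hJ⟩ := exists_primitive hh
  have hr : ∀ x : E n, ‖x‖ ≤ r → ‖x‖ ≤ r + 1 := fun x hx => by linarith
  refine energy_antitoneOn (A := A) (B := B) (C := C) (p := p) (r := r)
    (V := fun t => δ⁻¹ • ((u (t + δ)).fn - (u t).fn)) (V' := fun t => δ⁻¹ • (v (t + δ) - v t))
    (H := fun t => δ⁻¹ • (J (t + δ) - J t)) (G := fun t => δ⁻¹ • (I (t + δ) - I t))
    (G' := fun t => δ⁻¹ • ((u (t + δ)).grad - (u t).grad))
    (fun t ht => hasDerivAt_difference_quotient huv hδ ht)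
    (fun t ht => hasDerivAt_difference_quotient hI hδ ht)
    (fun t ht => (u (t + δ)).2.smul_sub (u t).2 δ⁻¹)
    (fun t ht ψ hψ hψr => hwe.increment hh hu hv huv hI hJ hA hB hC ht (by linarith) hψ hψr δ⁻¹)
    (fun x hx => by rw [hA x (hr x hx)]; exact ha x)
    (fun x hx => by rw [hB x (hr x hx)]; exact hb x)
    (fun x hx => by rw [hC x (hr x hx)]; exact hc x) hp hw ?_ ?_ hs (hs.trans_le hst) hst
  · intro t ht x
    by_cases hx : ‖x‖ ≤ r
    · rw [hB x (hr x hx), hC x (hr x hx)]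
      exact hD t ht x
    · have hz : excess p t x = 0 := by
        rw [excess_apply, max_eq_right (by linarith [hp x (not_le.1 hx)])]
      have := hD t ht x
      rw [hz] at this ⊢
      simpa using this
  · intro t ht
    -- For `τ` in `[t, t + δ]`, `t < p x` implies `τ < p x + δ`, so the source is zero there and its
    -- primitive `J` does not change.
    have h1 := mulL_eq_of_deriv (weight p t) (s := t) (t := t + δ) (by linarith)
      (fun τ hτ => hJ τ (ht.trans_le hτ.1)) fun τ hτ => ?_
    · refine ae_eq_zero_of_mulL_weight ?_
      rw [map_smul, map_sub, h1, sub_self, smul_zero]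
    · refine mulL_weight_eq_zero ?_
      filter_upwards [hhs τ (ht.trans_le hτ.1)] with x hx hx'
      exact hx (ht.trans hx') (by linarith [hτ.2])

/-- Finite speed of propagation for a weight `p` whose gradient is controlled by the speed. -/
theorem IsSolution.ae_eq_zero_of_weight {a b c : E n → ℝ} {h : ℝ → L2 n} {u₀ : H1 n} {u₁ : L2 n}
    {u : ℝ → H1 n} (hsol : IsSolution a b c h u₀ u₁ u) (hh : ContinuousOn h (Ioi 0))
    (hac : Continuous a) (hbc : Continuous b) (hcc : Continuous c)
    (ha : ∀ x, 0 ≤ a x) (hb : ∀ x, 0 < b x) (hc : ∀ x, 0 < c x) {p : E n →ᵇ ℝ} {r : ℝ}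
    (hp : ∀ x, r < ‖x‖ → p x ≤ 0) (hw : ∀ t, 0 < t → ContDiff ℝ 1 (weight p t))
    (hD : ∀ t, 0 < t → ∀ x, ‖∇ (weight p t) x‖ ≤ 2 * excess p t x * Real.sqrt (c x / b x))
    {η : ℝ} (hη : 0 < η) (hhs : ∀ t, 0 < t → ∀ᵐ x, 0 < p x → t < p x + η → h t x = 0)
    (hu₀ : ∀ᵐ x, 0 < p x → u₀.fn x = 0) (hg₀ : ∀ᵐ x, 0 < p x → u₀.grad x = 0)
    (hu₁ : ∀ᵐ x, 0 < p x → u₁ x = 0) {t : ℝ} (ht : 0 < t) :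
    ∀ᵐ x, t < p x → (u t).fn x = 0 := by
  obtain ⟨v, hu, hv, huv, hu0, hv0, hwe⟩ := hsol
  obtain ⟨I, hI⟩ := exists_primitive (H1.continuous_grad.comp_continuousOn hu)
  obtain ⟨A, hA⟩ := exists_boundedContinuous_eqOn hac (r + 1)
  obtain ⟨B, hB⟩ := exists_boundedContinuous_eqOn hbc (r + 1)
  obtain ⟨C, hC⟩ := exists_boundedContinuous_eqOn hcc (r + 1)
  have hr : ∀ x : E n, ‖x‖ ≤ r → ‖x‖ ≤ r + 1 := fun x hx => by linarith
  -- The energy inequality for averages passes to the limit `δ → 0+`: the averages converge in `L²`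
  -- to `v` and to the gradient of `u`.
  have mono : ∀ s t, 0 < s → s ≤ t → energy B C p t (v t) (u t).grad ≤
      energy B C p s (v s) (u s).grad := by
    intro s t hs hst
    have hlim : ∀ t, 0 < t → Tendsto (fun δ : ℝ => energy B C p t
        (δ⁻¹ • ((u (t + δ)).fn - (u t).fn)) (δ⁻¹ • (I (t + δ) - I t))) (𝓝[>] 0)
        (𝓝 (energy B C p t (v t) (u t).grad)) := fun t ht => by
      have h1 : Tendsto (fun δ : ℝ => δ⁻¹ • ((u (t + δ)).fn - (u t).fn)) (𝓝[>] 0) (𝓝 (v t)) :=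
        tendsto_difference_quotient (f := fun s => (u s).fn) (huv t ht)
      have h2 : Tendsto (fun δ : ℝ => δ⁻¹ • (I (t + δ) - I t)) (𝓝[>] 0) (𝓝 (u t).grad) :=
        tendsto_difference_quotient (hI t ht)
      exact tendsto_energy B C p tendsto_const_nhds h1 h2
    refine le_of_tendsto_of_tendsto (hlim t (hs.trans_le hst)) (hlim s hs) ?_
    filter_upwards [Ioc_mem_nhdsGT hη] with δ hδ
    refine energy_average_le hwe hh hu hv huv hI hA hB hC ha hb hc hp hw hD hδ.1
      (fun t ht => ?_) hs hst
    filter_upwards [hhs t ht] with x hx hx₀ hx'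
    exact hx hx₀ (by linarith [hδ.2])
  have h0 : Tendsto (fun s => energy B C p s (v s) (u s).grad) (𝓝[>] 0) (𝓝 0) := by
    have := tendsto_energy B C p (tendsto_id.mono_left nhdsWithin_le_nhds) hv0
      ((H1.continuous_grad.tendsto u₀).comp hu0)
    rwa [energy_eq_zero hu₁ hg₀] at this
  have hvt : ∀ t, 0 < t → ∀ᵐ x, t < p x → v t x = 0 := by
    intro t ht
    refine ae_eq_zero_of_energy_nonpos (B := B) (C := C) (g := (u t).grad) ht hp
      (fun x hx => by rw [hB x (hr x hx)]; exact hb x)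
      (fun x hx => by rw [hC x (hr x hx)]; exact hc x) ?_
    refine ge_of_tendsto h0 ?_
    filter_upwards [Ioc_mem_nhdsGT ht] with s hs
    exact mono s t hs.1 hs.2
  refine ae_eq_zero_of_mulL_weight ?_
  -- On `{t < p}` the velocity vanishes at all times up to `t`, so `u` keeps the value it has in the
  -- limit at time 0.
  have hconst : ∀ s, 0 < s → s ≤ t → mulL n ℝ (weight p t) (u s).fn =
      mulL n ℝ (weight p t) (u t).fn := by
    intro s hs hst
    refine (mulL_eq_of_deriv (weight p t) hst (fun τ hτ => huv τ (hs.trans_le hτ.1))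
      fun τ hτ => mulL_weight_eq_zero ?_).symm
    filter_upwards [hvt τ (hs.trans_le hτ.1)] with x hx hx'
    exact hx (hτ.2.trans_lt hx')
  have hl : Tendsto (fun s => mulL n ℝ (weight p t) (u s).fn) (𝓝[>] 0)
      (𝓝 (mulL n ℝ (weight p t) u₀.fn)) :=
    ((mulL n ℝ (weight p t)).continuous.tendsto _).comp
      ((H1.continuous_fn.tendsto u₀).comp hu0)
  have hz : mulL n ℝ (weight p t) u₀.fn = 0 := by
    refine mulL_weight_eq_zero ?_
    filter_upwards [hu₀] with x hx hx'
    exact hx (ht.trans hx')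
  rw [hz] at hl
  refine tendsto_nhds_unique (tendsto_const_nhds.congr' ?_) hl
  filter_upwards [Ioc_mem_nhdsGT ht] with s hs
  exact (hconst s hs.1 hs.2).symm

/-! ### The weight built from an admissible `q` -/

theorem exists_norm_eq_of_one_le (hn : 1 ≤ n) {r : ℝ} (hr : 0 ≤ r) : ∃ x : E n, ‖x‖ = r := by
  have : Nonempty (Fin n) := ⟨⟨0, hn⟩⟩
  exact exists_norm_eq (E n) hr

theorem hasDerivAt_posPart_sq (y : ℝ) :
    HasDerivAt (fun y : ℝ => max y 0 ^ 2) (2 * max y 0) y := by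
  rcases lt_trichotomy y 0 with h | h | h
  · have : (fun y : ℝ => max y 0 ^ 2) =ᶠ[𝓝 y] fun _ => 0 := by
      filter_upwards [Iio_mem_nhds h] with z hz
      rw [max_eq_right (le_of_lt hz)]; norm_num
    rw [max_eq_right h.le, mul_zero]
    exact (hasDerivAt_const y (0 : ℝ)).congr_of_eventuallyEq this
  · subst h
    rw [max_self, mul_zero, hasDerivAt_iff_isLittleO]
    have h1 : (fun z : ℝ => z) =o[𝓝 0] fun _ => (1 : ℝ) := by
      rw [Asymptotics.isLittleO_one_iff]
      exact tendsto_id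
    have h2 := h1.mul_isBigO (Asymptotics.isBigO_refl (fun z : ℝ => z) (𝓝 0))
    refine (Asymptotics.IsBigO.of_bound 1 (Eventually.of_forall fun z => ?_)).trans_isLittleO
      (g := fun z : ℝ => z * z) (by simpa using h2)
    simp only [max_self, smul_zero, sub_zero, one_mul]
    rcases le_total z 0 with hz | hz
    · simp [max_eq_right hz, mul_self_nonneg]
    · simp [max_eq_left hz, sq]
  · have : (fun y : ℝ => max y 0 ^ 2) =ᶠ[𝓝 y] fun y => y ^ 2 := by
      filter_upwards [Ioi_mem_nhds h] with z hz
      rw [max_eq_left (le_of_lt hz)]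
    rw [max_eq_left h.le]
    have h2 := (hasDerivAt_pow 2 y).congr_of_eventuallyEq this
    simpa using h2

/-- This is the reason for the square in the weight: it removes the kink of the positive part. -/
theorem contDiff_posPart_sq : ContDiff ℝ 1 (fun y : ℝ => max y 0 ^ 2) := by
  rw [contDiff_one_iff_deriv]
  refine ⟨fun y => (hasDerivAt_posPart_sq y).differentiableAt, ?_⟩
  have : deriv (fun y : ℝ => max y 0 ^ 2) = fun y => 2 * max y 0 :=
    funext fun y => (hasDerivAt_posPart_sq y).deriv
  rw [this]
  fun_prop

/-- The parabola `d - d² / (2 L) - η`. -/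
def parabola (L η d : ℝ) : ℝ := d - d ^ 2 / (2 * L) - η

theorem parabola_le {L : ℝ} (hL : 0 < L) (η d : ℝ) : parabola L η d ≤ L / 2 - η := by
  have h : L / 2 - η - parabola L η d = (d - L) ^ 2 / (2 * L) := by
    rw [parabola]; field_simp; ring
  have : 0 ≤ (d - L) ^ 2 / (2 * L) := by positivity
  linarith

theorem parabola_add_le {L : ℝ} (hL : 0 < L) (η d : ℝ) : parabola L η d + η ≤ d := by
  have : 0 ≤ d ^ 2 / (2 * L) := by positivity
  rw [parabola]; linarith

/-- The range `0 < d < 2 * L` serves twice: there the slope `1 - d / L` of the parabola has modulus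
below 1, and it confines the weight to a bounded set once `q → ∞`. -/
theorem pos_of_parabola_pos {L η d : ℝ} (hL : 0 < L) (hη : 0 < η) (h : 0 < parabola L η d) :
    0 < d ∧ d < 2 * L := by
  have h1 := parabola_add_le hL η d
  have hd : 0 < d := by linarith
  refine ⟨hd, ?_⟩
  by_contra h'
  push Not at h'
  have h2 : d ≤ d ^ 2 / (2 * L) := by
    rw [le_div_iff₀ (by positivity)]; nlinarith
  rw [parabola] at h
  linarith

theorem hasDerivAt_parabola (L η d : ℝ) : HasDerivAt (parabola L η) (1 - d / L) d := by
  have h := (((hasDerivAt_id d).sub (((hasDerivAt_id d).pow 2).div_const (2 * L))).sub_const η)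
  refine h.congr_deriv ?_
  simp only [id, Nat.cast_ofNat, mul_one]
  rw [show (2 : ℝ) * d ^ (2 - 1) / (2 * L) = d / L by
    norm_num; exact mul_div_mul_left _ _ two_ne_zero]

theorem contDiff_parabola (L η : ℝ) : ContDiff ℝ 1 (parabola L η) := by
  unfold parabola; fun_prop

section Profile

variable {b c : E n → ℝ} {q : ℝ → ℝ}

theorem IsAdmissible.derivWithin_pos (hq : IsAdmissible b c q) (hn : 1 ≤ n) {r : ℝ} (hr : 0 ≤ r) :
    0 < derivWithin q (Ici 0) r := by
  obtain ⟨x, rfl⟩ := exists_norm_eq_of_one_le hn hr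
  exact (hq.2 x).1

theorem IsAdmissible.strictMonoOn (hq : IsAdmissible b c q) (hn : 1 ≤ n) :
    StrictMonoOn q (Ici 0) := by
  refine strictMonoOn_of_deriv_pos (convex_Ici 0) hq.1.continuousOn fun r hr => ?_
  rw [interior_Ici, mem_Ioi] at hr
  rw [← derivWithin_of_mem_nhds (Ici_mem_nhds hr)]
  exact hq.derivWithin_pos hn hr.le

theorem IsAdmissible.continuous_comp_norm (hq : IsAdmissible b c q) :
    Continuous fun x : E n => q ‖x‖ :=
  hq.1.continuousOn.comp_continuous continuous_norm fun x => norm_nonneg x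

theorem IsAdmissible.hasDerivAt (hq : IsAdmissible b c q) {r : ℝ} (hr : 0 < r) :
    HasDerivAt q (derivWithin q (Ici 0) r) r := by
  have hn : Ici (0 : ℝ) ∈ 𝓝 r := Ici_mem_nhds hr
  rw [derivWithin_of_mem_nhds hn]
  exact ((hq.1.contDiffAt hn).differentiableAt one_ne_zero).hasDerivAt

/-- The positive part of `d - d² / (2 L) - η` with `d = q(|x|) - q(R)`. -/
def IsAdmissible.profile (hq : IsAdmissible b c q) (R : ℝ) {L : ℝ} (hL : 0 < L) {η : ℝ}
    (hη : 0 < η) : E n →ᵇ ℝ :=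
  BoundedContinuousFunction.ofNormedAddCommGroup
    (fun x => max (parabola L η (q ‖x‖ - q R)) 0)
    (((contDiff_parabola L η).continuous.comp
      (hq.continuous_comp_norm.sub continuous_const)).max continuous_const) (L / 2)
    (fun x => by
      rw [Real.norm_of_nonneg (le_max_right _ _)]
      exact max_le (by linarith [parabola_le hL η (q ‖x‖ - q R)]) (by positivity))

variable {R L η : ℝ} {hL : 0 < L} {hη : 0 < η}

theorem IsAdmissible.profile_apply (hq : IsAdmissible b c q) (x : E n) :
    hq.profile R hL hη x = max (parabola L η (q ‖x‖ - q R)) 0 := rfl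

theorem IsAdmissible.parabola_pos (hq : IsAdmissible b c q) {x : E n}
    (hx : 0 < hq.profile R hL hη x) : 0 < parabola L η (q ‖x‖ - q R) := by
  rw [hq.profile_apply] at hx
  by_contra h
  rw [max_eq_right (not_lt.1 h)] at hx
  exact lt_irrefl _ hx

theorem IsAdmissible.lt_norm_of_profile_pos (hq : IsAdmissible b c q) (hn : 1 ≤ n) (hR : 0 ≤ R)
    {x : E n} (hx : 0 < hq.profile R hL hη x) : R < ‖x‖ := by
  have h := (pos_of_parabola_pos hL hη (hq.parabola_pos hx)).1
  exact (hq.strictMonoOn hn).lt_iff_lt hR (norm_nonneg x) |>.1 (by linarith)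

theorem IsAdmissible.weight_profile (hq : IsAdmissible b c q) {t : ℝ} (ht : 0 < t) :
    ⇑(weight (hq.profile R hL hη) t) =
      fun x => max (parabola L η (q ‖x‖ - q R) - t) 0 ^ 2 := by
  funext x
  rw [weight_apply, hq.profile_apply]
  congr 1
  rcases le_total (parabola L η (q ‖x‖ - q R)) 0 with h | h
  · rw [max_eq_right h, max_eq_right (by linarith), max_eq_right (by linarith)]
  · rw [max_eq_left h]

theorem IsAdmissible.excess_profile (hq : IsAdmissible b c q) {t : ℝ} (ht : 0 < t) (x : E n) :
    excess (hq.profile R hL hη) t x = max (parabola L η (q ‖x‖ - q R) - t) 0 := by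
  rw [excess_apply, hq.profile_apply]
  rcases le_total (parabola L η (q ‖x‖ - q R)) 0 with h | h
  · rw [max_eq_right h, max_eq_right (by linarith), max_eq_right (by linarith)]
  · rw [max_eq_left h]

/-- The norm is not differentiable at the origin; the profile is positive only where `‖x‖ > R ≥ 0`,
so by continuity it stays below `t` near 0. -/
theorem IsAdmissible.weight_profile_eventuallyEq_zero (hq : IsAdmissible b c q) (hn : 1 ≤ n)
    (hR : 0 ≤ R) {t : ℝ} (ht : 0 < t) :
    ⇑(weight (hq.profile R hL hη) t) =ᶠ[𝓝 0] fun _ => 0 := by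
  have h0 : hq.profile R hL hη 0 < t := by
    by_contra h
    have := hq.lt_norm_of_profile_pos hn hR (ht.trans_le (not_lt.1 h))
    rw [norm_zero] at this
    linarith
  have hc := (hq.profile R hL hη).continuous
  filter_upwards [(isOpen_lt hc continuous_const).mem_nhds h0] with x hx
  exact weight_eq_zero (le_of_lt hx)

theorem IsAdmissible.contDiff_weight_profile (hq : IsAdmissible b c q) (hn : 1 ≤ n)
    (hR : 0 ≤ R) {t : ℝ} (ht : 0 < t) : ContDiff ℝ 1 (weight (hq.profile R hL hη) t) := by
  rw [contDiff_iff_contDiffAt]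
  intro x
  rcases eq_or_ne x 0 with rfl | hx
  · exact contDiffAt_const.congr_of_eventuallyEq
      (hq.weight_profile_eventuallyEq_zero hn hR ht)
  · rw [hq.weight_profile ht]
    have h1 : ContDiffAt ℝ 1 (fun x : E n => q ‖x‖) x :=
      (hq.1.contDiffAt (Ici_mem_nhds (norm_pos_iff.2 hx))).comp x (contDiffAt_norm ℝ hx)
    have h2 : ContDiffAt ℝ 1 (fun x : E n => parabola L η (q ‖x‖ - q R) - t) x :=
      ((contDiff_parabola L η).contDiffAt.comp x (h1.sub contDiffAt_const)).sub contDiffAt_const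
    exact contDiff_posPart_sq.contDiffAt.comp x h2

theorem IsAdmissible.norm_gradient_weight_profile_le (hq : IsAdmissible b c q) (hn : 1 ≤ n)
    (hR : 0 ≤ R) {t : ℝ} (ht : 0 < t) (x : E n) :
    ‖∇ (weight (hq.profile R hL hη) t) x‖ ≤
      2 * excess (hq.profile R hL hη) t x * Real.sqrt (c x / b x) := by
  have hs : 0 ≤ excess (hq.profile R hL hη) t x := le_max_right _ _
  rw [norm_gradient]
  rcases eq_or_ne x 0 with rfl | hx
  · rw [(hq.weight_profile_eventuallyEq_zero hn hR ht).fderiv_eq]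
    simp only [fderiv_fun_const, Pi.zero_apply, norm_zero]
    positivity
  · have hx0 := norm_pos_iff.2 hx
    have hnorm : HasFDerivAt (fun x : E n => ‖x‖) (fderiv ℝ (fun x : E n => ‖x‖) x) x :=
      ((contDiffAt_norm (n := 1) ℝ hx).differentiableAt one_ne_zero).hasFDerivAt
    have hn1 : ‖fderiv ℝ (fun x : E n => ‖x‖) x‖ ≤ 1 := by
      simpa using norm_fderiv_le_of_lipschitz ℝ (x₀ := x) (lipschitzWith_one_norm (E := E n))
    have hout : HasDerivAt (fun r : ℝ => max (parabola L η (q r - q R) - t) 0 ^ 2)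
        (2 * max (parabola L η (q ‖x‖ - q R) - t) 0 *
          ((1 - (q ‖x‖ - q R) / L) * derivWithin q (Ici 0) ‖x‖)) ‖x‖ := by
      have h1 := (hasDerivAt_parabola L η (q ‖x‖ - q R)).comp ‖x‖
        ((hq.hasDerivAt hx0).sub_const (q R))
      exact (hasDerivAt_posPart_sq _).comp ‖x‖ (h1.sub_const t)
    have hfd := hout.comp_hasFDerivAt x hnorm
    have hfd' : fderiv ℝ (fun x : E n => max (parabola L η (q ‖x‖ - q R) - t) 0 ^ 2) x = _ :=
      hfd.fderiv
    rw [hq.weight_profile ht, hfd', hq.excess_profile ht, norm_smul]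
    have hq' := hq.2 x
    set s := max (parabola L η (q ‖x‖ - q R) - t) 0 with hsdef
    have hs0 : 0 ≤ s := le_max_right _ _
    have hk : ‖2 * s * ((1 - (q ‖x‖ - q R) / L) * derivWithin q (Ici 0) ‖x‖)‖ ≤
        2 * s * Real.sqrt (c x / b x) := by
      rcases hs0.eq_or_lt with h | h
      · simp [← h]
      · have hpos : 0 < parabola L η (q ‖x‖ - q R) := by
          by_contra h'
          rw [hsdef, max_eq_right (by linarith)] at h
          exact lt_irrefl _ h
        obtain ⟨hd0, hd1⟩ := pos_of_parabola_pos hL hη hpos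
        have hd2 : |1 - (q ‖x‖ - q R) / L| ≤ 1 := by
          have h3 : 0 < (q ‖x‖ - q R) / L := by positivity
          have h4 : (q ‖x‖ - q R) / L < 2 := by rw [div_lt_iff₀ hL]; linarith
          rw [abs_le]; constructor <;> linarith
        rw [norm_mul, Real.norm_of_nonneg (by positivity : 0 ≤ 2 * s), norm_mul,
          Real.norm_of_nonneg hq'.1.le, Real.norm_eq_abs]
        refine mul_le_mul_of_nonneg_left ?_ (by positivity)
        calc |1 - (q ‖x‖ - q R) / L| * derivWithin q (Ici 0) ‖x‖
            ≤ 1 * derivWithin q (Ici 0) ‖x‖ := mul_le_mul_of_nonneg_right hd2 hq'.1.le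
          _ ≤ Real.sqrt (c x / b x) := by rw [one_mul]; exact hq'.2
    calc _ ≤ (2 * s * Real.sqrt (c x / b x)) * 1 :=
          mul_le_mul hk hn1 (norm_nonneg _) (by positivity)
      _ = _ := mul_one _

/-- Finite speed of propagation in terms of an admissible `q` tending to infinity. -/
theorem IsSolution.ae_eq_zero {a : E n → ℝ} {h : ℝ → L2 n} {u₀ : H1 n} {u₁ : L2 n}
    {u : ℝ → H1 n} (hsol : IsSolution a b c h u₀ u₁ u) (hh : ContinuousOn h (Ioi 0))
    (hac : Continuous a) (hbc : Continuous b) (hcc : Continuous c)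
    (ha : ∀ x, 0 ≤ a x) (hb : ∀ x, 0 < b x) (hc : ∀ x, 0 < c x) (hn : 1 ≤ n)
    (hq : IsAdmissible b c q) (hlim : Tendsto q atTop atTop) (hR : 0 ≤ R)
    (hhs : ∀ t : ℝ, 0 < t → ∀ᵐ x : E n, t + q R < q ‖x‖ → h t x = 0)
    (hu₀ : ∀ᵐ x : E n, R < ‖x‖ → u₀.fn x = 0) (hu₁ : ∀ᵐ x : E n, R < ‖x‖ → u₁ x = 0)
    {t : ℝ} (ht : 0 < t) : ∀ᵐ x : E n, t + q R < q ‖x‖ → (u t).fn x = 0 := by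
  have hg₀ : ∀ᵐ x : E n, R < ‖x‖ → u₀.grad x = 0 :=
    u₀.2.ae_eq_zero (U := {x | R < ‖x‖}) (isOpen_lt continuous_const continuous_norm) hu₀
  have key : ∀ k : ℕ, ∀ᵐ x : E n,
      t < hq.profile R (L := (k : ℝ) + 1) (by positivity) (η := 1 / ((k : ℝ) + 1)) (by positivity) x
        → (u t).fn x = 0 := by
    intro k
    have hL : (0 : ℝ) < (k : ℝ) + 1 := by positivity
    have hη : (0 : ℝ) < 1 / ((k : ℝ) + 1) := by positivity
    -- Beyond radius `r` one has `d ≥ 2 L`, where the parabola is not positive.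
    obtain ⟨r, hr⟩ := (hlim.eventually_ge_atTop (q R + 2 * ((k : ℝ) + 1))).exists_forall_of_atTop
    refine hsol.ae_eq_zero_of_weight hh hac hbc hcc ha hb hc (r := r) (fun x hx => ?_)
      (fun t ht => hq.contDiff_weight_profile hn hR ht)
      (fun t ht => hq.norm_gradient_weight_profile_le hn hR ht) hη (fun t ht => ?_) ?_ ?_ ?_ ht
    · by_contra hpos
      have := pos_of_parabola_pos hL hη (hq.parabola_pos (not_le.1 hpos))
      linarith [hr ‖x‖ hx.le]
    · filter_upwards [hhs t ht] with x hx hx0 hxt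
      refine hx ?_
      have h1 := hq.parabola_pos hx0
      rw [hq.profile_apply, max_eq_left h1.le] at hxt
      -- The shift by `η` pays for the time average: the parabola plus `η` is at most `d`, so `t <
      -- d`.
      linarith [parabola_add_le hL (1 / ((k : ℝ) + 1)) (q ‖x‖ - q R)]
    · filter_upwards [hu₀] with x hx hx0
      exact hx (hq.lt_norm_of_profile_pos hn hR hx0)
    · filter_upwards [hg₀] with x hx hx0
      exact hx (hq.lt_norm_of_profile_pos hn hR hx0)
    · filter_upwards [hu₁] with x hx hx0
      exact hx (hq.lt_norm_of_profile_pos hn hR hx0)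
  -- Countably many profiles share one null set, so `k` may depend on `x`.
  filter_upwards [ae_all_iff.2 key] with x hx hxt
  set d := q ‖x‖ - q R with hd
  have hl : Tendsto (fun k : ℕ => parabola ((k : ℝ) + 1) (1 / ((k : ℝ) + 1)) d) atTop (𝓝 d) := by
    have h0 : Tendsto (fun k : ℕ => 1 / ((k : ℝ) + 1)) atTop (𝓝 0) :=
      tendsto_one_div_add_atTop_nhds_zero_nat
    have h1 := (tendsto_const_nhds (x := d)).sub (h0.const_mul (d ^ 2 / 2))
    have h2 := h1.sub h0
    simp only [mul_zero, sub_zero] at h2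
    refine h2.congr fun k => ?_
    have : (k : ℝ) + 1 ≠ 0 := by positivity
    rw [parabola]; field_simp
  obtain ⟨k, hk⟩ := (hl.eventually_const_lt (show t < d by rw [hd]; linarith)).exists
  refine hx k ?_
  rw [hq.profile_apply]
  exact hk.trans_le (le_max_left _ _)

end Profile

/-! ### Existence of an admissible `q`, and the conclusion -/

theorem PowerBounds.pos {f : E n → ℝ} {k₀ k₁ e : ℝ} (h : PowerBounds f k₀ k₁ e) (hk : 0 < k₀)
    (x : E n) : 0 < f x := by
  have : 0 < 1 + ‖x‖ := by positivity
  exact (by positivity : 0 < k₀ * (1 + ‖x‖) ^ e).trans_le (h x).1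

/-- A power of `1 + r` is admissible. -/
theorem exists_isAdmissible {b c : E n → ℝ} {β γ b₀ b₁ c₀ c₁ : ℝ} (hb₀ : 0 < b₀) (hb₁ : 0 < b₁)
    (hc₀ : 0 < c₀) (hb : PowerBounds b b₀ b₁ β) (hc : PowerBounds c c₀ c₁ (-γ))
    (hβγ : β + γ < 2) :
    ∃ (q : ℝ → ℝ) (q₀ : ℝ), IsAdmissible b c q ∧ 0 < q₀ ∧
      ∀ x : E n, q₀ * ‖x‖ ^ (1 - (β + γ) / 2) ≤ q ‖x‖ := by
  set σ := 1 - (β + γ) / 2 with hσ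
  have hσ0 : 0 < σ := by rw [hσ]; linarith
  set κ := Real.sqrt (c₀ / b₁) with hκ
  have hκ0 : 0 < κ := Real.sqrt_pos.2 (by positivity)
  have hd : ∀ r : ℝ, 0 ≤ r → HasDerivAt (fun r => κ / σ * (1 + r) ^ σ) (κ * (1 + r) ^ (σ - 1)) r := by
    intro r hr
    have h1 : HasDerivAt (fun r : ℝ => 1 + r) 1 r := (hasDerivAt_id r).const_add 1
    have h2 := (h1.rpow_const (p := σ) (Or.inl (by linarith))).const_mul (κ / σ)
    refine h2.congr_deriv ?_
    field_simp
  -- The power bounds give `c / b ≥ (c₀ / b₁) (1 + |x|) ^ (-β - γ)`, whose root is `κ (1 + |x|) ^ (σ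
  -- - 1)`; `q` is a primitive of it, and `q₀ = κ / σ` because `1 + r ≥ r`.
  refine ⟨fun r => κ / σ * (1 + r) ^ σ, κ / σ, ⟨?_, fun x => ?_⟩, by positivity, fun x => ?_⟩
  · refine contDiffOn_const.mul (ContDiffOn.rpow_const_of_ne (by fun_prop) fun r hr => ?_)
    rw [mem_Ici] at hr
    linarith
  · have hx := norm_nonneg x
    have h1 : 0 < 1 + ‖x‖ := by positivity
    rw [(hd ‖x‖ hx).hasDerivWithinAt.derivWithin (uniqueDiffOn_Ici 0 ‖x‖ hx)]
    refine ⟨by positivity, Real.le_sqrt_of_sq_le ?_⟩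
    have hbx := hb.pos hb₀ x
    rw [mul_pow, hκ, Real.sq_sqrt (by positivity), le_div_iff₀ hbx]
    calc c₀ / b₁ * ((1 + ‖x‖) ^ (σ - 1)) ^ 2 * b x
        ≤ c₀ / b₁ * ((1 + ‖x‖) ^ (σ - 1)) ^ 2 * (b₁ * (1 + ‖x‖) ^ β) :=
          mul_le_mul_of_nonneg_left (hb x).2 (by positivity)
      _ = c₀ * (((1 + ‖x‖) ^ (σ - 1)) ^ 2 * (1 + ‖x‖) ^ β) := by field_simp
      _ = c₀ * (1 + ‖x‖) ^ (-γ) := by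
          rw [← Real.rpow_natCast, ← Real.rpow_mul h1.le, ← Real.rpow_add h1]
          congr 2
          rw [hσ]; push_cast; ring
      _ ≤ c x := (hc x).1
  · refine mul_le_mul_of_nonneg_left ?_ (by positivity)
    exact Real.rpow_le_rpow (norm_nonneg x) (by linarith) hσ0.le

theorem tendsto_atTop_of_rpow_le (hn : 1 ≤ n) {q : ℝ → ℝ} {q₀ σ : ℝ} (hq₀ : 0 < q₀) (hσ : 0 < σ)
    (hq : ∀ x : E n, q₀ * ‖x‖ ^ σ ≤ q ‖x‖) : Tendsto q atTop atTop := by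
  refine tendsto_atTop_mono' atTop ?_ ((tendsto_rpow_atTop hσ).const_mul_atTop hq₀)
  filter_upwards [eventually_ge_atTop 0] with r hr
  obtain ⟨x, rfl⟩ := exists_norm_eq_of_one_le hn hr
  exact hq x

end DampedWave

end

theorem corollaryA2 (n : ℕ) (hn : 1 ≤ n)
    (a b c : DampedWave.E n → ℝ)
    (ha : ContDiff ℝ ∞ a) (hb : ContDiff ℝ ∞ b) (hc : ContDiff ℝ ∞ c)
    (α β γ a₀ a₁ b₀ b₁ c₀ c₁ : ℝ)
    (ha₀ : 0 < a₀) (ha₁ : 0 < a₁) (hb₀ : 0 < b₀) (hb₁ : 0 < b₁) (hc₀ : 0 < c₀) (hc₁ : 0 < c₁)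
    (hab : DampedWave.PowerBounds a a₀ a₁ (-α))
    (hbb : DampedWave.PowerBounds b b₀ b₁ β)
    (hcb : DampedWave.PowerBounds c c₀ c₁ (-γ))
    (hβγ : β + γ < 2) :
    (∃ (q : ℝ → ℝ) (q₀ : ℝ), DampedWave.IsAdmissible b c q ∧ 0 < q₀ ∧
      ∀ x : DampedWave.E n, q₀ * ‖x‖ ^ (1 - (β + γ) / 2) ≤ q ‖x‖) ∧
    (∀ (q : ℝ → ℝ) (q₀ : ℝ), DampedWave.IsAdmissible b c q → 0 < q₀ →
      (∀ x : DampedWave.E n, q₀ * ‖x‖ ^ (1 - (β + γ) / 2) ≤ q ‖x‖) →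
      ∀ (R : ℝ), 0 ≤ R →
      ∀ (h : ℝ → DampedWave.L2 n) (u₀ : DampedWave.H1 n) (u₁ : DampedWave.L2 n)
        (u : ℝ → DampedWave.H1 n),
        ContinuousOn h (Ioi 0) →
        (∀ t : ℝ, 0 < t → ∀ᵐ x : DampedWave.E n, t + q R < q ‖x‖ → h t x = 0) →
        DampedWave.IsSolution a b c h u₀ u₁ u →
        (∀ᵐ x : DampedWave.E n, R < ‖x‖ → u₀.fn x = 0) →
        (∀ᵐ x : DampedWave.E n, R < ‖x‖ → u₁ x = 0) →
        ∀ t : ℝ, 0 < t → ∀ᵐ x : DampedWave.E n,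
          ((t + q R) / q₀) ^ (2 / (2 - β - γ)) < ‖x‖ → (u t).fn x = 0) := by
  have hσ : 0 < 1 - (β + γ) / 2 := by linarith
  refine ⟨DampedWave.exists_isAdmissible hb₀ hb₁ hc₀ hbb hcb hβγ, ?_⟩
  intro q q₀ hq hq₀ hqq R hR h u₀ u₁ u hh hhs hsol hu₀ hu₁ t ht
  have hlim := DampedWave.tendsto_atTop_of_rpow_le hn hq₀ hσ hqq
  filter_upwards [hsol.ae_eq_zero hh ha.continuous hb.continuous hc.continuous
    (fun x => (hab.pos ha₀ x).le) (hbb.pos hb₀) (hcb.pos hc₀) hn hq hlim hR hhs hu₀ hu₁ ht]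
    with x hx hxt
  refine hx ?_
  -- Nonnegativity of `q R` follows from (*) at a point of norm `R`; it makes the base of the power
  -- positive, as needed to invert it.
  have hqR : 0 ≤ q R := by
    obtain ⟨y, rfl⟩ := DampedWave.exists_norm_eq_of_one_le hn hR
    exact le_trans (by positivity) (hqq y)
  have he : 2 / (2 - β - γ) = (1 - (β + γ) / 2)⁻¹ := by
    rw [← one_div, div_eq_div_iff (by linarith) hσ.ne']
    ring
  rw [he, Real.rpow_inv_lt_iff_of_pos (by positivity) (norm_nonneg x) hσ, div_lt_iff₀' hq₀] at hxt
  exact hxt.trans_le (hqq x)
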